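/- Let $n\ge 8$ be divisible by $4$, let $k=n/2$, and let $G$ be a balanced $k$-partite graph on $n$ vertices, that is, a graph whose vertex set is partitioned into $k$ independent sets (the parts) of the same size $n/k=2$. Then $\frac n2+\left\lfloor\frac{n+2}{k+2}\right\rfloor-\frac nk=\frac n2-1$, and if $\delta(G)\ge \frac n2-1$ and $G$ has no Hamiltonian cycle, then at least one of the following holds. (i) $G\in\mathcal F_1$: the parts of $G$ can be labelled $V_i=\{x_i,y_i\}$, $i\in[k]$, so that $x_1,\dots,x_k$ are pairwise adjacent, $y_k$ is adjacent to $y_1,\dots,y_{k-1}$, each $y_i$ with $i\in[k-1]$ has at least $k-1$ neighbours in $(\{y_1,\dots,y_k\}\setminus\{y_i\})\cup\{x_k\}$, and $G$ has no edges between $\{x_1,\dots,x_k\}$ and $\{y_1,\dots,y_k\}$ other than edges from $x_k$ to some of $y_1,\dots,y_{k-1}$. (ii) $n=8$ and $G\cong F_2$, where $F_2$ is the graph with vertices $x_1,\dots,x_6,x',x''$ and the $15$ edges $x_1x_2$, $x_2x_3$, $x_3x_4$, $x_4x_5$, $x_5x_6$, $x_6x_1$, $x'x''$, $x'x_1$,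 $x'x_4$, $x''x_1$, $x''x_4$, $x_1x_3$, $x_1x_5$, $x_4x_2$, $x_4x_6$. (iii) $G\in\mathcal F_3$: the parts of $G$ can be labelled $X_1,\dots,X_{k/2},Y_1,\dots,Y_{k/2}$ so that, with $X=\bigcup_i X_i$ and $Y=\bigcup_i Y_i$, there are vertices $y'\in Y_{k/2}$, $y''\in Y\setminus\{y'\}$ and $x'\in X$ such that $X$ is independent, every vertex of $X$ is adjacent to every vertex of $Y\setminus\{y',y''\}$, $y''$ is adjacent to every vertex of $X\setminus\{x'\}$, and the neighbourhood of $y'$ is exactly $\{x'\}\cup(Y\setminus Y_{k/2})$. (Other edges between the parts $Y_1,\dots,Y_{k/2}$, and the edge $x'y''$, may be present or absent.) -/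

import Mathlib

/-- A `k`-partite graph is a graph `G` with a proper colouring `c` by `Fin k`, whose colour classes
are the parts. It is balanced if all the parts have the same size. -/
def IsBalancedPartite {V : Type*} {G : SimpleGraph V} {k : ℕ} (c : G.Coloring (Fin k)) : Prop :=
  ∀ i j : Fin k, {v | c v = i}.ncard = {v | c v = j}.ncard

/-- The family `𝓕₁`. The parts are `V_i = {x i, y i}`; one index `m` is distinguished.
The `x i` form a clique; `y m` is adjacent to all the other `y i`; for `i ≠ m` the vertex `y i` has
at least `k - 1` neighbours in `{y j | j ≠ i} ∪ {x m}`; there are no further edges. -/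
def InFamilyOne {V : Type*} {G : SimpleGraph V} {k : ℕ} (c : G.Coloring (Fin k)) : Prop :=
  ∃ (x y : Fin k → V) (m : Fin k),
    (∀ i, x i ≠ y i ∧ {v | c v = i} = {x i, y i}) ∧
    (∀ i j, i ≠ j → G.Adj (x i) (x j)) ∧
    (∀ i, i ≠ m → G.Adj (y m) (y i)) ∧
    (∀ i, i ≠ m → k - 1 ≤ {w | G.Adj (y i) w ∧ ((∃ j, j ≠ i ∧ w = y j) ∨ w = x m)}.ncard) ∧
    (∀ i j, G.Adj (x i) (y j) → i = m ∧ j ≠ m)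

/-- The graph `F₂`: the vertices `0, …, 5` form a 6-cycle in this order, `6` and `7` are adjacent
to each other and both to `0` and `3`, and there are the chords `02`, `04`, `31`, `35`. -/
def graphFTwo : SimpleGraph (Fin 8) :=
  SimpleGraph.fromEdgeSet
    {s(0, 1), s(1, 2), s(2, 3), s(3, 4), s(4, 5), s(5, 0),
     s(6, 7), s(6, 0), s(6, 3), s(7, 0), s(7, 3),
     s(0, 2), s(0, 4), s(3, 1), s(3, 5)}

/-- The family `𝓕₃`. All parts have two elements; `I` is the set of indices of half of the parts,
`X` is the union of these parts and `Y` that of the others. With `y₁` and `y₂` two different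
vertices of `Y` and `x₁` a vertex of `X`: `X` is independent; every vertex of `X` is adjacent to
every vertex of `Y` other than `y₁, y₂`; `y₂` is adjacent to every vertex of `X` other than `x₁`
(and may or may not be adjacent to `x₁`); the only neighbour of `y₁` in `X` is `x₁`; the vertex
`y₁` is adjacent to exactly the vertices of `Y` outside its own part; the other edges between the
parts inside `Y` are arbitrary. -/
def InFamilyThree {V : Type*} {G : SimpleGraph V} {k : ℕ} (c : G.Coloring (Fin k)) : Prop :=
  ∃ (I : Finset (Fin k)) (y₁ y₂ x₁ : V),
    (∀ i, {v | c v = i}.ncard = 2) ∧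
    2 * I.card = k ∧
    c y₁ ∉ I ∧ c y₂ ∉ I ∧ y₂ ≠ y₁ ∧ c x₁ ∈ I ∧
    (∀ u v, c u ∈ I → c v ∈ I → ¬ G.Adj u v) ∧
    (∀ u v, c u ∈ I → c v ∉ I → v ≠ y₁ → v ≠ y₂ → G.Adj u v) ∧
    (∀ u, c u ∈ I → u ≠ x₁ → G.Adj y₂ u) ∧
    (∀ u, c u ∈ I → (G.Adj y₁ u ↔ u = x₁)) ∧
    (∀ v, c v ∉ I → (G.Adj y₁ v ↔ c v ≠ c y₁))

/-!
Write `n = 2 * k` with `k` even. Every part has two vertices, and the degree condition reads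
`k - 1 ≤ δ(G)`. Suppose that `G` has no Hamiltonian cycle. The proof looks at long cycles and paths.

*Cycles and longest paths with `n - 1` vertices.* The missed vertex `w` has no two consecutive
neighbours on such a cycle or path, so its `k - 1` neighbours form the set `A` of the vertices in
even positions. Exchanging `w` with a vertex in an odd position shows that `k - 1` vertices have the
neighbourhood `A`. They are paired up by the parts, except that `k - 1` is odd; hence one of their
parts meets the two remaining vertices, which gives `𝓕₃` (`IsIndexedPath.inFamilyThree`,
`inFamilyThree_of_split`).

*Shorter longest paths.* A longest path with fewer than `n - 1` vertices closes up to a cycle by the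
usual crossing argument, so its vertices form a component, which has `k` vertices
(`inFamily_or_hasPathOfCard`). A set of `k` vertices joined to the rest at one vertex only is a
clique by the degree condition, and this gives `𝓕₁` (`inFamilyOne_of_card_eq`).

*A Hamiltonian path `p 1, …, p n`, and no cycle with `n - 1` or `n` vertices.* If `p n` is adjacent
to `p t`, then `p 1` is adjacent neither to `p (t + 1)` nor to `p (t + 2)`. Either no
neighbour of `p 1` comes after one of `p n`; by the degrees these neighbourhoods then almost fill the two
halves of the path, and rotating the path yields a cut vertex and so `𝓕₁`
(`IsExtremalPath.inFamilyOne_of_not_cross`). Or the neighbourhoods are the intervals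
`[2, a] ∪ [b + 3, e]` and `[a, b] ∪ [e, n - 1]` (`IsExtremalPath.exists_hasInterlacedEnds`); rotations
then force `a = b = 3`, `e = 6`, `n = 8` (`HasInterlacedEnds.parameters_eq`), and `G` is `F₂`
(`HasInterlacedEnds.nonempty_iso`).
-/

/-! ### Paths and cycles given by numbered vertices -/

/-- The vertices `p 1, …, p m` are distinct and form a path of `G` in this order; the other values
of `p` are irrelevant. Positions start at `1`, so that `p 0` is free to name a further vertex. -/
structure IsIndexedPath {V : Type*} (G : SimpleGraph V) (p : ℕ → V) (m : ℕ) : Prop where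
  injOn : Set.InjOn p (Set.Icc 1 m)
  adj : ∀ i, 1 ≤ i → i < m → G.Adj (p i) (p (i + 1))

/-- `G` has a path with `m` vertices. -/
def HasPathOfCard {V : Type*} (G : SimpleGraph V) (m : ℕ) : Prop :=
  ∃ p : ℕ → V, IsIndexedPath G p m

/-- `G` has a cycle with `m` vertices (for `m ≤ 2` this allows degenerate cycles). -/
def HasCycleOfCard {V : Type*} (G : SimpleGraph V) (m : ℕ) : Prop :=
  ∃ p : ℕ → V, IsIndexedPath G p m ∧ G.Adj (p m) (p 1)

/-- The positions in `s` can be arranged in a sequence from `a` to `b`, without repetition, such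
that `p` maps consecutive positions to adjacent vertices. -/
def Traverses {V : Type*} (G : SimpleGraph V) (p : ℕ → V) (a b : ℕ) (s : Finset ℕ) : Prop :=
  ∃ l : List ℕ, l.Nodup ∧ l.toFinset = s ∧ l.IsChain (fun i j => G.Adj (p i) (p j)) ∧
    l.head? = some a ∧ l.getLast? = some b

section IndexedPaths

variable {V : Type*} {G : SimpleGraph V} {p : ℕ → V} {a b d e m n : ℕ} {s t : Finset ℕ}

lemma Traverses.append (h₁ : Traverses G p a b s) (h₂ : Traverses G p d e t)
    (hadj : G.Adj (p b) (p d)) (hst : ∀ i ∈ s, i ∉ t) : Traverses G p a e (s ∪ t) := by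
  obtain ⟨l, hl, rfl, hc, hh, ht⟩ := h₁
  obtain ⟨l', hl', rfl, hc', hh', ht'⟩ := h₂
  refine ⟨l ++ l', ?_, by simp, ?_, ?_, ?_⟩
  · refine hl.append hl' fun x hx hx' => hst x (by simpa using hx) (by simpa using hx')
  · refine List.isChain_append.2 ⟨hc, hc', ?_⟩
    intro x hx y hy
    simp_all
  · simp [hh]
  · simp [ht']

lemma Traverses.reverse (h : Traverses G p a b s) : Traverses G p b a s := by
  obtain ⟨l, hl, rfl, hc, hh, ht⟩ := h
  refine ⟨l.reverse, by simpa, by simp, ?_, by simpa, by simpa⟩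
  rw [List.isChain_reverse]
  exact hc.imp fun _ _ h => h.symm

lemma traverses_singleton (G : SimpleGraph V) (p : ℕ → V) (a : ℕ) : Traverses G p a a {a} :=
  ⟨[a], by simp, by simp, by simp, by simp, by simp⟩

lemma traverses_Icc (hab : a ≤ b) (h : ∀ i, a ≤ i → i < b → G.Adj (p i) (p (i + 1))) :
    Traverses G p a b (Finset.Icc a b) := by
  induction b, hab using Nat.le_induction with
  | base => simpa using traverses_singleton G p a
  | succ b hab ih =>
    have := (ih fun i h₁ h₂ => h i h₁ (by omega)).append (traverses_singleton G p (b + 1))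
      (h b hab (by omega)) (by simp; omega)
    convert this using 1
    ext; simp; omega

/-- An ascending stretch of a path. -/
lemma IsIndexedPath.up (hp : IsIndexedPath G p m) (ha : 1 ≤ a) (hab : a ≤ b) (hb : b ≤ m) :
    Traverses G p a b (Finset.Icc a b) :=
  traverses_Icc hab fun i h₁ h₂ => hp.adj i (by omega) (by omega)

/-- A descending stretch of a path. -/
lemma IsIndexedPath.down (hp : IsIndexedPath G p m) (ha : 1 ≤ a) (hab : a ≤ b) (hb : b ≤ m) :
    Traverses G p b a (Finset.Icc a b) :=
  (hp.up ha hab hb).reverse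

lemma Traverses.exists_isIndexedPath (h : Traverses G p a b s) (hs : Set.InjOn p s) :
    ∃ q : ℕ → V, IsIndexedPath G q s.card ∧ q 1 = p a ∧ q s.card = p b ∧
      ∀ v, (∃ i ∈ Set.Icc 1 s.card, q i = v) ↔ ∃ i ∈ s, p i = v := by
  obtain ⟨l, hl, rfl, hc, hh, ht⟩ := h
  have hlen : l.toFinset.card = l.length := List.toFinset_card_of_nodup hl
  have hne : l ≠ [] := by rintro rfl; simp at hh
  have hpos : 0 < l.length := List.length_pos_iff.2 hne
  rw [hlen]
  refine ⟨fun i => p (l.getD (i - 1) 0), ⟨?_, ?_⟩, ?_, ?_, ?_⟩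
  · intro i hi j hj hij
    obtain ⟨hi₁, hi₂⟩ := hi
    obtain ⟨hj₁, hj₂⟩ := hj
    have hi' : i - 1 < l.length := by omega
    have hj' : j - 1 < l.length := by omega
    simp only [List.getD_eq_getElem _ _ hi', List.getD_eq_getElem _ _ hj'] at hij
    have := hs (by simp) (by simp) hij
    have := (List.Nodup.getElem_inj_iff hl).1 this
    omega
  · intro i hi₁ hi₂
    have hi' : i - 1 < l.length := by omega
    have hi'' : i + 1 - 1 < l.length := by omega
    simp only [List.getD_eq_getElem _ _ hi', List.getD_eq_getElem _ _ hi'']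
    have := List.isChain_iff_getElem.1 hc (i - 1) (by omega)
    convert this using 3
    omega
  · rw [List.head?_eq_getElem?] at hh
    simp [List.getD_eq_getElem?_getD, hh]
  · rw [List.getLast?_eq_getElem?] at ht
    simp [List.getD_eq_getElem?_getD, ht]
  · intro v
    constructor
    · rintro ⟨i, ⟨hi₁, hi₂⟩, rfl⟩
      have hi' : i - 1 < l.length := by omega
      exact ⟨l[i - 1], by simp, by simp [hi']⟩
    · rintro ⟨i, hi, rfl⟩
      obtain ⟨j, hj, rfl⟩ := List.getElem_of_mem (List.mem_toFinset.1 hi)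
      exact ⟨j + 1, ⟨by omega, by omega⟩, by simp [hj]⟩

lemma Traverses.hasPathOfCard (h : Traverses G p a b s) (hs : Set.InjOn p s) :
    HasPathOfCard G s.card := by
  obtain ⟨q, hq, -⟩ := h.exists_isIndexedPath hs
  exact ⟨q, hq⟩

lemma Traverses.hasCycleOfCard (h : Traverses G p a b s) (hs : Set.InjOn p s)
    (hba : G.Adj (p b) (p a)) : HasCycleOfCard G s.card := by
  obtain ⟨q, hq, h₁, h₂, -⟩ := h.exists_isIndexedPath hs
  exact ⟨q, hq, by rwa [h₁, h₂]⟩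

lemma IsIndexedPath.reflect (hp : IsIndexedPath G p m) :
    IsIndexedPath G (fun i => p (m + 1 - i)) m := by
  refine ⟨?_, ?_⟩
  · intro i ⟨hi₁, hi₂⟩ j ⟨hj₁, hj₂⟩ hij
    have := hp.injOn ⟨by omega, by omega⟩ ⟨by omega, by omega⟩ hij
    omega
  · intro i h₁ h₂
    have := hp.adj (m + 1 - (i + 1)) (by omega) (by omega)
    rw [show m + 1 - (i + 1) + 1 = m + 1 - i by omega] at this
    exact this.symm

lemma IsIndexedPath.mono (hp : IsIndexedPath G p n) (hmn : m ≤ n) : IsIndexedPath G p m :=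
  ⟨hp.injOn.mono (Set.Icc_subset_Icc_right hmn), fun i h₁ h₂ => hp.adj i h₁ (by omega)⟩

lemma IsIndexedPath.card_image (hp : IsIndexedPath G p m) [DecidableEq V] {s : Finset ℕ}
    (hs : s ⊆ Finset.Icc 1 m) : (s.image p).card = s.card :=
  Finset.card_image_of_injOn (hp.injOn.mono fun i hi => by simpa using hs hi)

/-- A path on all the vertices reaches each of them. -/
lemma IsIndexedPath.exists_eq [Fintype V] (hp : IsIndexedPath G p (Fintype.card V)) (v : V) :
    ∃ i, 1 ≤ i ∧ i ≤ Fintype.card V ∧ p i = v := by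
  classical
  have h : (Finset.Icc 1 (Fintype.card V)).image p = Finset.univ := by
    rw [← Finset.card_eq_iff_eq_univ, hp.card_image (Finset.Subset.refl _)]
    simp
  have := Finset.mem_univ v
  rw [← h] at this
  simpa [and_assoc] using this

lemma HasCycleOfCard.isHamiltonian [Fintype V] [DecidableEq V] (hV : 3 ≤ Fintype.card V)
    (h : HasCycleOfCard G (Fintype.card V)) : G.IsHamiltonian := by
  obtain ⟨p, hp, hadj⟩ := h
  intro _
  obtain ⟨l, hl, hls, hc, hh, ht⟩ := hp.up le_rfl (by omega) le_rfl
  have hlen : l.length = Fintype.card V := by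
    rw [← List.toFinset_card_of_nodup hl, hls]; simp
  have hne : l.map p ≠ [] := by
    intro h; simp at h; simp [h] at hh
  have hchain : (l.map p).IsChain G.Adj := by
    rwa [List.isChain_map]
  have hhead : (l.map p).head hne = p 1 := by
    rw [List.head_map]; congr 1
    exact (List.head_eq_iff_head?_eq_some _).2 hh
  have hlast : (l.map p).getLast hne = p (Fintype.card V) := by
    rw [List.getLast_map]; congr 1
    exact (List.getLast_eq_iff_getLast?_eq_some _).2 ht
  have hadj' : G.Adj ((l.map p).getLast hne) ((l.map p).head hne) := by rwa [hhead, hlast]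
  have hnd : (l.map p).Nodup := by
    refine hl.map_on ?_
    intro i hi j hj hij
    have hmem : ∀ i ∈ l, i ∈ Set.Icc 1 (Fintype.card V) := by
      intro i hi
      rw [← List.mem_toFinset, hls] at hi
      simpa using hi
    exact hp.injOn (hmem i hi) (hmem j hj) hij
  have hlength : (SimpleGraph.Walk.cons hadj'
      (SimpleGraph.Walk.ofSupport (l.map p) hne hchain)).length = Fintype.card V := by
    simp [hlen]; omega
  refine ⟨_, SimpleGraph.Walk.cons hadj' (SimpleGraph.Walk.ofSupport (l.map p) hne hchain), ?_⟩
  rw [SimpleGraph.Walk.isHamiltonianCycle_iff_isCycle_and_length_eq]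
  refine ⟨?_, hlength⟩
  rw [SimpleGraph.Walk.isCycle_iff_isPath_tail_and_le_length]
  refine ⟨?_, by omega⟩
  rw [SimpleGraph.Walk.isPath_def, SimpleGraph.Walk.support_tail_of_not_nil _ (by simp)]
  simpa only [SimpleGraph.Walk.support_cons, List.tail_cons,
    SimpleGraph.Walk.support_ofSupport] using hnd

end IndexedPaths

/-! ### Parts with two vertices and recognition of the families -/

/-- `σ` exchanges the two vertices of each part of the colouring `c`; in particular every part has
exactly two vertices. -/
structure IsPartnerMap {V : Type*} {G : SimpleGraph V} {k : ℕ} (c : G.Coloring (Fin k))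
    (σ : V → V) : Prop where
  ne : ∀ v, σ v ≠ v
  color : ∀ v, c (σ v) = c v
  eq_or_eq : ∀ u v, c u = c v → u = v ∨ u = σ v

section Parts

variable {V : Type*} {G : SimpleGraph V} {k : ℕ} {c : G.Coloring (Fin k)} {σ : V → V}

namespace IsPartnerMap

lemma involutive (h : IsPartnerMap c σ) (v : V) : σ (σ v) = v := by
  rcases h.eq_or_eq (σ (σ v)) v (by rw [h.color, h.color]) with h' | h'
  · exact h'
  · exact absurd h' (h.ne _)

lemma not_adj (h : IsPartnerMap c σ) (v : V) : ¬ G.Adj v (σ v) := fun hadj =>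
  c.valid hadj (h.color v).symm

lemma not_adj_left (h : IsPartnerMap c σ) (v : V) : ¬ G.Adj (σ v) v := fun hadj =>
  c.valid hadj (h.color v)

lemma part_eq (h : IsPartnerMap c σ) (v : V) : {w | c w = c v} = {v, σ v} := by
  ext w
  simp only [Set.mem_ofPred_eq, Set.mem_insert_iff, Set.mem_singleton_iff]
  refine ⟨h.eq_or_eq w v, ?_⟩
  rintro (rfl | rfl)
  · rfl
  · exact h.color v

/-- A union of parts has an even number of vertices. -/
lemma even_card (h : IsPartnerMap c σ) {s : Finset V} (hs : ∀ v ∈ s, σ v ∈ s) : Even s.card := by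
  have := Finset.sum_involution (s := s) (f := fun _ => (1 : ZMod 2)) (fun v _ => σ v)
    (fun _ _ => by decide) (fun v _ _ => h.ne v) hs (fun v _ => h.involutive v)
  rw [Finset.sum_const, nsmul_eq_mul, mul_one] at this
  rw [even_iff_two_dvd]
  exact (ZMod.natCast_eq_zero_iff _ _).1 this

end IsPartnerMap

lemma exists_isPartnerMap [Fintype V] (hbal : IsBalancedPartite c)
    (hV : Fintype.card V = 2 * k) :
    (∀ i, {v | c v = i}.ncard = 2) ∧ ∃ σ, IsPartnerMap c σ := by
  classical
  have htwo : ∀ i, {v | c v = i}.ncard = 2 := by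
    intro i
    have hk : 0 < k := i.pos
    have h₁ : Fintype.card V = ∑ j : Fin k, {v | c v = j}.ncard := by
      rw [← Finset.card_univ, Finset.card_eq_sum_card_fiberwise (f := c) (t := Finset.univ)
        (by simp)]
      refine Finset.sum_congr rfl fun j _ => ?_
      rw [← Set.ncard_coe_finset]
      congr 1
      ext; simp
    rw [Finset.sum_congr rfl (fun j _ => hbal j i)] at h₁
    simp only [Finset.sum_const, Finset.card_univ, Fintype.card_fin, smul_eq_mul] at h₁
    rw [hV, mul_comm] at h₁
    exact (Nat.eq_of_mul_eq_mul_left hk h₁).symm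
  refine ⟨htwo, ?_⟩
  have hex : ∀ v, ∃ w, w ≠ v ∧ c w = c v ∧ ∀ u, c u = c v → u = v ∨ u = w := by
    intro v
    obtain ⟨x, y, hxy, hs⟩ := Set.ncard_eq_two.1 (htwo (c v))
    have hm : ∀ u, c u = c v ↔ u = x ∨ u = y := by
      intro u
      have : u ∈ {w | c w = c v} ↔ u ∈ ({x, y} : Set V) := by rw [hs]
      simpa using this
    rcases (hm v).1 rfl with rfl | rfl
    · exact ⟨y, hxy.symm, (hm y).2 (Or.inr rfl), fun u hu => (hm u).1 hu⟩
    · exact ⟨x, hxy, (hm x).2 (Or.inl rfl), fun u hu => ((hm u).1 hu).symm⟩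
  choose σ h₁ h₂ h₃ using hex
  exact ⟨σ, h₁, h₂, fun u v huv => h₃ v u huv⟩

lemma IsPartnerMap.card_colors [DecidableEq V] (h : IsPartnerMap c σ) (s : Finset V)
    (hs : ∀ v ∈ s, σ v ∈ s) : 2 * (s.image c).card = s.card := by
  have := Finset.card_eq_sum_card_image c s
  rw [this, Finset.sum_const_nat (m := 2), mul_comm]
  intro i hi
  obtain ⟨v, hv, rfl⟩ := Finset.mem_image.1 hi
  rw [Finset.card_eq_two]
  refine ⟨v, σ v, (h.ne v).symm, ?_⟩
  ext w
  simp only [Finset.mem_filter, Finset.mem_insert, Finset.mem_singleton]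
  constructor
  · exact fun hw => h.eq_or_eq w v hw.2
  · rintro (rfl | rfl)
    · exact ⟨hv, rfl⟩
    · exact ⟨hs v hv, h.color v⟩

/-- A vertex whose neighbours lie in a set no larger than its degree is adjacent to all of it. -/
lemma adj_of_forall_adj_mem [Fintype V] [DecidableRel G.Adj] {v : V} {s : Finset V}
    (hs : ∀ w, G.Adj v w → w ∈ s) (hcard : s.card ≤ G.degree v) {w : V} (hw : w ∈ s) : G.Adj v w := by
  have : G.neighborFinset v = s :=
    Finset.eq_of_subset_of_card_le (fun w hw => hs w (by simpa using hw))
      (by rwa [SimpleGraph.card_neighborFinset_eq_degree])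
  rw [← this] at hw
  simpa using hw

variable [Fintype V] [DecidableEq V] [DecidableRel G.Adj]

/-- A set `A` of `k` vertices whose only edges to the outside are at a single vertex `z` puts `G`
in `𝓕₁`: by the degree condition `A` is a clique, so it meets every part exactly once. -/
lemma inFamilyOne_of_card_eq (h : IsPartnerMap c σ) (hV : Fintype.card V = 2 * k)
    (hdeg : ∀ v, k - 1 ≤ G.degree v) (A : Finset V) (z : V) (hz : z ∈ A) (hA : A.card = k)
    (hcut : ∀ u ∈ A, u ≠ z → ∀ v, v ∉ A → ¬ G.Adj u v) : InFamilyOne c := by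
  have hclique' : ∀ u ∈ A, u ≠ z → ∀ v ∈ A, v ≠ u → G.Adj u v := by
    intro u hu huz v hv hvu
    refine adj_of_forall_adj_mem (s := A.erase u) (fun w hw => ?_) ?_ (by simp [hv, hvu])
    · refine Finset.mem_erase.2 ⟨hw.ne.symm, ?_⟩
      by_contra hwA
      exact hcut u hu huz w hwA hw
    · rw [Finset.card_erase_of_mem hu, hA]; exact hdeg u
  have hclique : ∀ u ∈ A, ∀ v ∈ A, v ≠ u → G.Adj u v := by
    intro u hu v hv hvu
    by_cases huz : u = z
    · subst huz
      exact (hclique' v hv hvu u hu hvu.symm).symm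
    · exact hclique' u hu huz v hv hvu
  have hinj : Set.InjOn c A := by
    intro u hu v hv huv
    by_contra hne
    exact c.valid (hclique u hu v hv (Ne.symm hne)) huv
  have himage : A.image c = Finset.univ := by
    rw [← Finset.card_eq_iff_eq_univ, Finset.card_image_of_injOn hinj, hA, Fintype.card_fin]
  have hx : ∀ i, ∃ v ∈ A, c v = i := by
    intro i
    have := Finset.mem_univ i
    rw [← himage] at this
    simpa using this
  choose x hxA hxc using hx
  have hxuniq : ∀ v ∈ A, v = x (c v) := fun v hv => hinj hv (hxA _) (hxc _).symm
  have hyA : ∀ i, σ (x i) ∉ A := by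
    intro i hi
    exact h.ne (x i) (hinj hi (hxA i) (h.color _))
  have hyuniq : ∀ v, v ∉ A → v = σ (x (c v)) := by
    intro v hv
    rcases h.eq_or_eq v (x (c v)) (hxc _).symm with h' | h'
    · exact absurd (h' ▸ hxA _) hv
    · exact h'
  have hzx : z = x (c z) := hxuniq z hz
  refine ⟨x, fun i => σ (x i), c z, ?_, ?_, ?_, ?_, ?_⟩
  · intro i
    refine ⟨(h.ne _).symm, ?_⟩
    rw [← h.part_eq (x i), hxc]
  · intro i j hij
    refine hclique _ (hxA i) _ (hxA j) ?_
    intro he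
    apply hij
    rw [← hxc i, ← hxc j, he]
  · intro i hi
    change G.Adj (σ (x (c z))) (σ (x i))
    rw [← hzx]
    refine adj_of_forall_adj_mem (s := Aᶜ.erase (σ z)) (fun w hw => ?_) ?_ ?_
    · refine Finset.mem_erase.2 ⟨hw.ne.symm, Finset.mem_compl.2 fun hwA => ?_⟩
      by_cases hwz : w = z
      · subst hwz; exact h.not_adj_left _ hw
      · exact hcut w hwA hwz (σ z) (by rw [hzx]; exact hyA _) hw.symm
    · rw [Finset.card_erase_of_mem (by simp only [Finset.mem_compl]; rw [hzx]; exact hyA _),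
        Finset.card_compl, hA, hV]
      have := hdeg (σ z)
      omega
    · refine Finset.mem_erase.2 ⟨fun he => hi ?_, Finset.mem_compl.2 (hyA i)⟩
      have := congrArg c he
      rwa [h.color, h.color, hxc] at this
  · intro i _
    refine (hdeg (σ (x i))).trans ?_
    rw [← SimpleGraph.card_neighborFinset_eq_degree, ← Set.ncard_coe_finset]
    refine Set.ncard_le_ncard ?_ (Set.toFinite _)
    intro w hw
    have hw : G.Adj (σ (x i)) w := by simpa using hw
    refine ⟨hw, ?_⟩
    by_cases hwA : w ∈ A
    · right
      rw [← hzx]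
      by_contra hwz
      exact hcut w hwA hwz _ (hyA i) hw.symm
    · left
      refine ⟨c w, ?_, hyuniq w hwA⟩
      rintro rfl
      exact hw.ne (hyuniq w hwA).symm
  · intro i j hadj
    have hi : i = c z := by
      by_contra hne
      refine hcut (x i) (hxA i) (fun he => hne ?_) _ (hyA j) hadj
      rw [← he, hxc]
    refine ⟨hi, ?_⟩
    rintro rfl
    subst hi
    exact h.not_adj _ hadj

/-- The case of `inFamilyThree_of_split` in which the part of `p` meets `W`. The independent side
`X` of the family is `W ∪ {p}`, and `q` is its exceptional vertex `y'`. -/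
lemma inFamilyThree_of_partner_mem (h : IsPartnerMap c σ)
    (hk : Even k) (htwo : ∀ i, {v | c v = i}.ncard = 2) (hdeg : ∀ v, k - 1 ≤ G.degree v)
    {W A : Finset V} {p q : V}
    (hWA : Disjoint W A) (hpW : p ∉ W) (hqW : q ∉ W) (hpA : p ∉ A) (hqA : q ∉ A) (hpq : p ≠ q)
    (hcover : ∀ v, v ∈ W ∨ v ∈ A ∨ v = p ∨ v = q)
    (hWcard : W.card = k - 1) (hAcard : A.card = k - 1)
    (hW : ∀ w ∈ W, ∀ v, G.Adj w v ↔ v ∈ A) (hk3 : 3 ≤ k) (hσp : σ p ∈ W) : InFamilyThree c := by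
  have hWσ : ∀ w ∈ W, σ w ∉ A := fun w hw hA => h.not_adj w ((hW w hw _).2 hA)
  have hσp' : ∀ v, σ v = p → v = σ p := fun v hv => by rw [← hv, h.involutive]
  -- if the part of `q` met `W` too, the parts would pair up the remaining `k - 3` vertices of `W`
  have hσq : σ q ∉ W := by
    intro hσq
    have hne : σ p ≠ σ q := fun he => hpq (by rw [← h.involutive p, he, h.involutive])
    have heven : Even ((W.erase (σ p)).erase (σ q)).card := by
      refine h.even_card fun v hv => ?_
      simp only [Finset.mem_erase] at hv ⊢
      obtain ⟨hvq, hvp, hvW⟩ := hv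
      refine ⟨fun he => hqW ?_, fun he => hpW ?_, ?_⟩
      · rw [← h.involutive v, he, h.involutive] at hvW; exact hvW
      · rw [← h.involutive v, he, h.involutive] at hvW; exact hvW
      · rcases hcover (σ v) with h' | h' | h' | h'
        · exact h'
        · exact absurd h' (hWσ v hvW)
        · exact absurd (by rw [← h', h.involutive]) hvp
        · exact absurd (by rw [← h', h.involutive]) hvq
    rw [Finset.card_erase_of_mem (Finset.mem_erase.2 ⟨hne.symm, hσq⟩),
      Finset.card_erase_of_mem hσp, hWcard] at heven
    obtain ⟨a, ha⟩ := hk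
    obtain ⟨b, hb⟩ := heven
    omega
  have hσqA : σ q ∈ A := by
    rcases hcover (σ q) with h' | h' | h' | h'
    · exact absurd h' hσq
    · exact h'
    · exact absurd (hσp' q h' ▸ hσp) hqW
    · exact absurd h' (h.ne q)
  have hpadj : ∀ v, G.Adj p v → v ∈ A ∨ v = q := by
    intro v hv
    rcases hcover v with h' | h' | h' | h'
    · exact absurd ((hW v h' p).1 hv.symm) hpA
    · exact Or.inl h'
    · exact absurd h'.symm hv.ne
    · exact Or.inr h'
  have hqadj : ∀ v, G.Adj q v ↔ v ∈ insert p (A.erase (σ q)) := by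
    have hsub : ∀ v, G.Adj q v → v ∈ insert p (A.erase (σ q)) := by
      intro v hv
      rw [Finset.mem_insert, Finset.mem_erase]
      rcases hcover v with h' | h' | h' | h'
      · exact absurd ((hW v h' q).1 hv.symm) hqA
      · exact Or.inr ⟨fun he => h.not_adj q (he ▸ hv), h'⟩
      · exact Or.inl h'
      · exact absurd h'.symm hv.ne
    refine fun v => ⟨hsub v, adj_of_forall_adj_mem hsub ?_⟩
    rw [Finset.card_insert_of_notMem (by simp [hpA]), Finset.card_erase_of_mem hσqA, hAcard]
    have := hdeg q
    omega
  have hpqadj : G.Adj q p := (hqadj p).2 (by simp)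
  -- a vertex of `A` such that `p` is adjacent to all the other ones
  obtain ⟨y, hyA, hy⟩ : ∃ y ∈ A, ∀ v ∈ A, v ≠ y → G.Adj p v := by
    by_cases hall : ∀ v ∈ A, G.Adj p v
    · exact ⟨σ q, hσqA, fun v hv _ => hall v hv⟩
    · push Not at hall
      obtain ⟨y, hyA, hy⟩ := hall
      refine ⟨y, hyA, fun v hv hvy => ?_⟩
      refine adj_of_forall_adj_mem (s := insert q (A.erase y)) (fun w hw => ?_) ?_
        (by simp [hv, hvy])
      · rw [Finset.mem_insert, Finset.mem_erase]
        rcases hpadj w hw with h' | h'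
        · exact Or.inr ⟨fun he => hy (he ▸ hw), h'⟩
        · exact Or.inl h'
      · rw [Finset.card_insert_of_notMem (by simp [hqA]), Finset.card_erase_of_mem hyA, hAcard]
        have := hdeg p
        omega
  have hXσ : ∀ v ∈ insert p W, σ v ∈ insert p W := by
    intro v hv
    rw [Finset.mem_insert] at hv ⊢
    rcases hv with rfl | hv
    · exact Or.inr hσp
    · rcases hcover (σ v) with h' | h' | h' | h'
      · exact Or.inr h'
      · exact absurd h' (hWσ v hv)
      · exact Or.inl h'
      · exact absurd (by rw [← h', h.involutive]; exact hv) hσq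
  have hI : ∀ v, c v ∈ (insert p W).image c ↔ v = p ∨ v ∈ W := by
    intro v
    rw [← Finset.mem_insert, Finset.mem_image]
    constructor
    · rintro ⟨u, hu, huv⟩
      rcases h.eq_or_eq v u huv.symm with rfl | rfl
      · exact hu
      · exact hXσ u hu
    · exact fun hv => ⟨v, hv, rfl⟩
  have hnI : ∀ v, c v ∉ (insert p W).image c ↔ v = q ∨ v ∈ A := by
    intro v
    rw [hI]
    constructor
    · intro hv
      rcases hcover v with h' | h' | h' | h' <;> tauto
    · rintro (rfl | hv)
      · exact fun h' => h'.elim (fun e => hpq e.symm) hqW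
      · exact fun h' => h'.elim (fun e => hpA (e ▸ hv))
          (fun e => (Finset.disjoint_left.1 hWA e hv))
  refine ⟨(insert p W).image c, q, y, p, htwo, ?_, ?_, ?_, ?_, ?_, ?_, ?_, ?_, ?_, ?_⟩
  · rw [h.card_colors _ hXσ, Finset.card_insert_of_notMem hpW, hWcard]; omega
  · exact (hnI q).2 (Or.inl rfl)
  · exact (hnI y).2 (Or.inr hyA)
  · rintro rfl; exact hqA hyA
  · exact (hI p).2 (Or.inl rfl)
  · intro u v hu hv hadj
    have hvA : v ∉ A := fun hvA => (hnI v).2 (Or.inr hvA) hv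
    rcases (hI u).1 hu with rfl | hu
    · rcases hpadj v hadj with h' | rfl
      · exact hvA h'
      · exact (hnI v).2 (Or.inl rfl) hv
    · exact hvA ((hW u hu v).1 hadj)
  · intro u v hu hv hvq hvy
    have hvA : v ∈ A := ((hnI v).1 hv).resolve_left hvq
    rcases (hI u).1 hu with rfl | hu
    · exact hy v hvA hvy
    · exact (hW u hu v).2 hvA
  · intro u hu hup
    exact ((hW u (((hI u).1 hu).resolve_left hup) y).2 hyA).symm
  · intro u hu
    rw [hqadj, Finset.mem_insert]
    refine ⟨fun h' => h'.resolve_right fun h'' => ?_, Or.inl⟩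
    exact (hnI u).2 (Or.inr (Finset.mem_of_mem_erase h'')) hu
  · intro v hv
    refine ⟨fun hadj he => c.valid hadj he.symm, fun hne => ?_⟩
    rw [hqadj, Finset.mem_insert, Finset.mem_erase]
    rcases (hnI v).1 hv with rfl | hvA
    · exact absurd rfl hne
    · refine Or.inr ⟨?_, hvA⟩
      rintro rfl
      exact hne (h.color q)

/-- If `W` consists of `k - 1` vertices with the same neighbourhood `A`, where `A` has `k - 1`
vertices, then `G` is in `𝓕₃`. Since `k - 1` is odd, the part of some vertex of `W` meets the two
vertices `p`, `q` outside `W ∪ A`. -/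
lemma inFamilyThree_of_split (h : IsPartnerMap c σ)
    (hk : Even k) (htwo : ∀ i, {v | c v = i}.ncard = 2) (hdeg : ∀ v, k - 1 ≤ G.degree v)
    {W A : Finset V} {p q : V}
    (hWA : Disjoint W A) (hpW : p ∉ W) (hqW : q ∉ W) (hpA : p ∉ A) (hqA : q ∉ A) (hpq : p ≠ q)
    (hcover : ∀ v, v ∈ W ∨ v ∈ A ∨ v = p ∨ v = q)
    (hWcard : W.card = k - 1) (hAcard : A.card = k - 1)
    (hW : ∀ w ∈ W, ∀ v, G.Adj w v ↔ v ∈ A) (hk3 : 3 ≤ k) : InFamilyThree c := by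
  by_cases hp : σ p ∈ W
  · exact inFamilyThree_of_partner_mem h hk htwo hdeg hWA hpW hqW hpA hqA hpq hcover hWcard
      hAcard hW hk3 hp
  by_cases hq : σ q ∈ W
  · exact inFamilyThree_of_partner_mem h hk htwo hdeg hWA hqW hpW hqA hpA hpq.symm
      (fun v => by rcases hcover v with h' | h' | h' | h' <;> simp [h']) hWcard hAcard hW hk3 hq
  exfalso
  have heven : Even W.card := by
    refine h.even_card fun w hw => ?_
    rcases hcover (σ w) with h' | h' | h' | h'
    · exact h'
    · exact absurd ((hW w hw _).2 h') (h.not_adj w)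
    · exact absurd (by rw [← h', h.involutive]; exact hw) hp
    · exact absurd (by rw [← h', h.involutive]; exact hw) hq
  obtain ⟨a, ha⟩ := hk
  obtain ⟨b, hb⟩ := heven
  omega

end Parts

/-! ### Cycles and longest paths missing one vertex -/

/-- A set of `r` integers in `[2, 2r]` without two consecutive elements consists of the even
numbers: each of the pairs `{2j, 2j + 1}` contains exactly one element, and `2r + 1` is excluded. -/
lemma mem_iff_even_of_not_consecutive {r : ℕ} {s : Finset ℕ} (hs : s ⊆ Finset.Icc 2 (2 * r))
    (hcons : ∀ i ∈ s, i + 1 ∉ s) (hcard : r ≤ s.card) {i : ℕ} (h₂ : 2 ≤ i) (hi : i ≤ 2 * r) :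
    i ∈ s ↔ Even i := by
  have hinj : Set.InjOn (fun i => i / 2) s := by
    intro a ha b hb hab
    simp only at hab
    by_contra hne
    rcases Nat.lt_or_gt_of_ne hne with h | h
    · have : b = a + 1 := by omega
      subst this; exact hcons a ha hb
    · have : a = b + 1 := by omega
      subst this; exact hcons b hb ha
  have himage : s.image (fun i => i / 2) = Finset.Icc 1 r := by
    refine Finset.eq_of_subset_of_card_le ?_ ?_
    · intro j hj
      obtain ⟨a, ha, rfl⟩ := Finset.mem_image.1 hj
      have := Finset.mem_Icc.1 (hs ha)
      rw [Finset.mem_Icc]; omega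
    · rw [Finset.card_image_of_injOn hinj]; simpa using hcard
  have hpair : ∀ j, 1 ≤ j → j ≤ r → 2 * j ∈ s ∨ 2 * j + 1 ∈ s := by
    intro j h₁ h₂
    have : j ∈ s.image (fun i => i / 2) := by rw [himage, Finset.mem_Icc]; omega
    obtain ⟨a, ha, haj⟩ := Finset.mem_image.1 this
    have : a = 2 * j ∨ a = 2 * j + 1 := by omega
    rcases this with rfl | rfl
    · exact Or.inl ha
    · exact Or.inr ha
  have heven : ∀ d j, j + d = r → 1 ≤ j → 2 * j ∈ s := by
    intro d
    induction d with
    | zero =>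
      intro j hj h₁
      refine (hpair j h₁ (by omega)).resolve_right fun h => ?_
      have := Finset.mem_Icc.1 (hs h)
      omega
    | succ d ih =>
      intro j hj h₁
      refine (hpair j h₁ (by omega)).resolve_right fun h => ?_
      exact hcons _ h (ih (j + 1) (by omega) (by omega))
  rcases Nat.even_or_odd' i with ⟨j, rfl | rfl⟩
  · simp only [even_two, Even.mul_right, iff_true]
    exact heven (r - j) j (by omega) (by omega)
  · have : ¬ Even (2 * j + 1) := by rw [Nat.not_even_iff_odd]; exact ⟨j, rfl⟩
    simp only [this, iff_false]
    exact hcons _ (heven (r - j) j (by omega) (by omega))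

section AlmostSpanning

variable {V : Type*} {G : SimpleGraph V} {p : ℕ → V} {k m : ℕ}

/-- A vertex `p 0` off a path which has two consecutive neighbours on it can be inserted. -/
lemma IsIndexedPath.insert_hasPath (hp : IsIndexedPath G p m) (hinj : Set.InjOn p (Set.Icc 0 m))
    {i : ℕ} (h₁ : 1 ≤ i) (hi : i < m) (ha : G.Adj (p 0) (p i)) (hb : G.Adj (p 0) (p (i + 1))) :
    HasPathOfCard G (m + 1) := by
  have h := ((hp.up le_rfl h₁ hi.le).append (traverses_singleton G p 0) ha.symm
    (by simp; omega)).append (hp.up (by omega) hi le_rfl) hb (by simp; omega)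
  have := h.hasPathOfCard (hinj.mono (by intro x; simp; omega))
  convert this using 1
  have hs : Finset.Icc 1 i ∪ {0} ∪ Finset.Icc (i + 1) m = Finset.Icc 0 m := by
    ext; simp; omega
  rw [hs]; simp

lemma IsIndexedPath.insert_hasCycle (hp : IsIndexedPath G p m)
    (hinj : Set.InjOn p (Set.Icc 0 m)) (hclosed : G.Adj (p m) (p 1))
    {i : ℕ} (h₁ : 1 ≤ i) (hi : i < m) (ha : G.Adj (p 0) (p i)) (hb : G.Adj (p 0) (p (i + 1))) :
    HasCycleOfCard G (m + 1) := by
  have h := ((hp.up (by omega) hi le_rfl).append (hp.up le_rfl h₁ hi.le) hclosed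
    (by simp; omega)).append (traverses_singleton G p 0) ha.symm (by simp; omega)
  have := h.hasCycleOfCard (hinj.mono (by intro x; simp; omega)) hb
  convert this using 1
  have hs : Finset.Icc (i + 1) m ∪ Finset.Icc 1 i ∪ {0} = Finset.Icc 0 m := by
    ext; simp; omega
  rw [hs]; simp

lemma IsIndexedPath.insert_end_hasPath (hp : IsIndexedPath G p m) (hm : 1 ≤ m)
    (hinj : Set.InjOn p (Set.Icc 0 m)) (ha : G.Adj (p 0) (p 1)) : HasPathOfCard G (m + 1) := by
  have h := (traverses_singleton G p 0).append (hp.up le_rfl hm le_rfl) ha (by simp)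
  have := h.hasPathOfCard (hinj.mono (by intro x; simp; omega))
  convert this using 1
  have hs : {0} ∪ Finset.Icc 1 m = Finset.Icc 0 m := by
    ext; simp; omega
  rw [hs]; simp

lemma IsIndexedPath.insert_last_hasPath (hp : IsIndexedPath G p m) (hm : 1 ≤ m)
    (hinj : Set.InjOn p (Set.Icc 0 m)) (ha : G.Adj (p 0) (p m)) : HasPathOfCard G (m + 1) := by
  have h := (traverses_singleton G p 0).append (hp.down le_rfl hm le_rfl) ha (by simp)
  have := h.hasPathOfCard (hinj.mono (by intro x; simp; omega))
  convert this using 1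
  have hs : {0} ∪ Finset.Icc 1 m = Finset.Icc 0 m := by
    ext; simp; omega
  rw [hs]; simp

lemma IsIndexedPath.exists_zero_eq (hp : IsIndexedPath G p m) {w : V}
    (hw : ∀ i, 1 ≤ i → i ≤ m → p i ≠ w) :
    ∃ q : ℕ → V, q 0 = w ∧ (∀ i, 1 ≤ i → q i = p i) ∧ IsIndexedPath G q m ∧
      Set.InjOn q (Set.Icc 0 m) := by
  have hq : ∀ i, 1 ≤ i → Function.update p 0 w i = p i := fun i hi => by
    rw [Function.update_of_ne (by omega)]
  refine ⟨Function.update p 0 w, Function.update_self .., hq, ⟨?_, ?_⟩, ?_⟩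
  · intro i hi j hj hij
    rw [hq i hi.1, hq j hj.1] at hij
    exact hp.injOn hi hj hij
  · intro i h₁ h₂
    rw [hq i h₁, hq (i + 1) (by omega)]
    exact hp.adj i h₁ h₂
  · intro i hi j hj hij
    rcases Nat.eq_zero_or_pos i with rfl | hi' <;> rcases Nat.eq_zero_or_pos j with rfl | hj'
    · rfl
    · rw [hq j hj', Function.update_self] at hij
      exact absurd hij.symm (hw j hj' hj.2)
    · rw [hq i hi', Function.update_self] at hij
      exact absurd hij (hw i hi' hi.2)
    · rw [hq i hi', hq j hj'] at hij
      exact hp.injOn ⟨hi', hi.2⟩ ⟨hj', hj.2⟩ hij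

variable [Fintype V]

/-- A path missing at least one vertex can be renumbered off the path so that `p 0` is missed. -/
lemma IsIndexedPath.exists_off (hp : IsIndexedPath G p m) (hm : m < Fintype.card V) :
    ∃ q : ℕ → V, (∀ i, 1 ≤ i → q i = p i) ∧ IsIndexedPath G q m ∧
      Set.InjOn q (Set.Icc 0 m) := by
  classical
  obtain ⟨w, hw⟩ : ∃ w, w ∉ (Finset.Icc 1 m).image p := by
    by_contra! h
    have h' : (Finset.Icc 1 m).image p = Finset.univ := Finset.eq_univ_of_forall h
    rw [← Finset.card_univ, ← h', hp.card_image subset_rfl] at hm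
    simp at hm
  obtain ⟨q, -, hq⟩ := hp.exists_zero_eq fun i h₁ h₂ he =>
    hw (Finset.mem_image.2 ⟨i, by simp [h₁, h₂], he⟩)
  exact ⟨q, hq⟩

lemma exists_eq_of_injOn_Icc_zero (hinj : Set.InjOn p (Set.Icc 0 m))
    (hm : m + 1 = Fintype.card V) (v : V) : ∃ i, i ≤ m ∧ p i = v := by
  classical
  have h : (Finset.Icc 0 m).image p = Finset.univ := by
    rw [← Finset.card_eq_iff_eq_univ, Finset.card_image_of_injOn (by simpa using hinj)]
    simpa using hm
  have := Finset.mem_univ v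
  rw [← h] at this
  simpa using this

variable [DecidableRel G.Adj]

lemma IsIndexedPath.adj_zero_iff_even (hV : Fintype.card V = 2 * k)
    (hdeg : k - 1 ≤ G.degree (p 0)) (hinj : Set.InjOn p (Set.Icc 0 (2 * k - 1)))
    (h₁ : ¬ G.Adj (p 0) (p 1)) (hlast : ¬ G.Adj (p 0) (p (2 * k - 1)))
    (hcons : ∀ i, 1 ≤ i → i < 2 * k - 1 → G.Adj (p 0) (p i) → ¬ G.Adj (p 0) (p (i + 1)))
    {i : ℕ} (hi₁ : 1 ≤ i) (hi : i ≤ 2 * k - 1) : G.Adj (p 0) (p i) ↔ Even i := by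
  classical
  set s := (Finset.Icc 2 (2 * (k - 1))).filter fun i => G.Adj (p 0) (p i) with hs
  have hcard : k - 1 ≤ s.card := by
    refine hdeg.trans ?_
    rw [← SimpleGraph.card_neighborFinset_eq_degree]
    refine (Finset.card_le_card (t := s.image p) fun v hv => ?_).trans Finset.card_image_le
    have hv : G.Adj (p 0) v := by simpa using hv
    obtain ⟨j, hj, rfl⟩ := exists_eq_of_injOn_Icc_zero hinj (by omega) v
    refine Finset.mem_image.2 ⟨j, ?_, rfl⟩
    have hj0 : j ≠ 0 := by rintro rfl; exact hv.ne rfl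
    have hj1 : j ≠ 1 := by rintro rfl; exact h₁ hv
    have hj2 : j ≠ 2 * k - 1 := by rintro rfl; exact hlast hv
    simp only [hs, Finset.mem_filter, Finset.mem_Icc, hv, and_true]
    omega
  by_cases hi' : 2 ≤ i ∧ i ≤ 2 * (k - 1)
  · have := mem_iff_even_of_not_consecutive (s := s) (Finset.filter_subset _ _)
      (fun j hj hj' => ?_) hcard hi'.1 hi'.2
    · rw [← this]; simp [hs, hi']
    · simp only [hs, Finset.mem_filter, Finset.mem_Icc] at hj hj'
      exact hcons j (by omega) (by omega) hj.2 hj'.2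
  · have : i = 1 ∨ i = 2 * k - 1 := by omega
    rcases this with rfl | rfl
    · simp [h₁]
    · simp only [hlast, false_iff, Nat.not_even_iff_odd]
      exact ⟨k - 1, by omega⟩

variable [DecidableEq V] {c : G.Coloring (Fin k)} {σ : V → V}

/-- A path through all vertices but `p 0`, which is not adjacent to the ends of the path, puts `G`
in `𝓕₃` if the path closes up to a cycle, or if there is no longer path. In both cases the
neighbours of `p 0` are exactly the vertices in even positions, and `p 0` can be exchanged with each
inner vertex in an odd position, which therefore has the same neighbours. -/
lemma IsIndexedPath.inFamilyThree (h : IsPartnerMap c σ) (hV : Fintype.card V = 2 * k)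
    (hk : Even k) (hk4 : 4 ≤ k) (htwo : ∀ i, {v | c v = i}.ncard = 2)
    (hdeg : ∀ v, k - 1 ≤ G.degree v) (hcycle : ¬ HasCycleOfCard G (2 * k))
    (hp : IsIndexedPath G p (2 * k - 1)) (hinj : Set.InjOn p (Set.Icc 0 (2 * k - 1)))
    (hclosed : G.Adj (p (2 * k - 1)) (p 1) ∨ ¬ HasPathOfCard G (2 * k))
    (h₁ : ¬ G.Adj (p 0) (p 1)) (hlast : ¬ G.Adj (p 0) (p (2 * k - 1))) : InFamilyThree c := by
  have hcons : ∀ q : ℕ → V, IsIndexedPath G q (2 * k - 1) →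
      Set.InjOn q (Set.Icc 0 (2 * k - 1)) →
      (G.Adj (q (2 * k - 1)) (q 1) ∨ ¬ HasPathOfCard G (2 * k)) →
      ∀ i, 1 ≤ i → i < 2 * k - 1 → G.Adj (q 0) (q i) → ¬ G.Adj (q 0) (q (i + 1)) := by
    intro q hq hqinj hqc i hi₁ hi ha hb
    rcases hqc with hqc | hqc
    · have := hq.insert_hasCycle hqinj hqc hi₁ hi ha hb
      rw [show 2 * k - 1 + 1 = 2 * k by omega] at this
      exact hcycle this
    · have := hq.insert_hasPath hqinj hi₁ hi ha hb
      rw [show 2 * k - 1 + 1 = 2 * k by omega] at this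
      exact hqc this
  have hzero : ∀ i, 1 ≤ i → i ≤ 2 * k - 1 → (G.Adj (p 0) (p i) ↔ Even i) := fun i hi₁ hi =>
    IsIndexedPath.adj_zero_iff_even hV (hdeg _) hinj h₁ hlast (hcons p hp hinj hclosed) hi₁ hi
  have hodd : ∀ i, Odd i → 3 ≤ i → i ≤ 2 * k - 3 → ∀ j, j ≤ 2 * k - 1 →
      (G.Adj (p i) (p j) ↔ 1 ≤ j ∧ Even j) := by
    intro i hiodd hi₁ hi j hj
    have hev : ∀ j, 1 ≤ j → j ≤ 2 * k - 1 → Even j → G.Adj (p 0) (p j) := fun j h₁ h₂ h₃ =>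
      (hzero j h₁ h₂).2 h₃
    obtain ⟨e, he⟩ := hiodd
    have ha := hev (i - 1) (by omega) (by omega) ⟨e, by omega⟩
    have hb := hev (i + 1) (by omega) (by omega) ⟨e + 1, by omega⟩
    have h2 := hev 2 (by omega) (by omega) ⟨1, rfl⟩
    have hN := hev (2 * k - 2) (by omega) (by omega) ⟨k - 1, by omega⟩
    set q : ℕ → V := fun j => p (Equiv.swap 0 i j) with hqdef
    have hq0 : q 0 = p i := by simp [hqdef]
    have hqi : q i = p 0 := by simp [hqdef]
    have hqj : ∀ j, j ≠ 0 → j ≠ i → q j = p j := fun j h₁ h₂ => by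
      simp [hqdef, Equiv.swap_apply_of_ne_of_ne h₁ h₂]
    have hqinj : Set.InjOn q (Set.Icc 0 (2 * k - 1)) := by
      have hmem : ∀ a ∈ Set.Icc 0 (2 * k - 1), Equiv.swap 0 i a ∈ Set.Icc 0 (2 * k - 1) := by
        intro a ha
        rw [Equiv.swap_apply_def]
        simp only [Set.mem_Icc] at ha ⊢
        split_ifs <;> omega
      intro a ha b hb hab
      exact (Equiv.swap 0 i).injective (hinj (hmem a ha) (hmem b hb) hab)
    have hq : IsIndexedPath G q (2 * k - 1) := by
      refine ⟨hqinj.mono (Set.Icc_subset_Icc_left (by omega)), fun a ha₁ ha₂ => ?_⟩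
      by_cases hai : a = i
      · subst hai
        rw [hqi, hqj (a + 1) (by omega) (by omega)]; exact hb
      by_cases hai' : a + 1 = i
      · rw [hai', hqi, hqj a (by omega) (by omega)]
        rw [show a = i - 1 by omega]; exact ha.symm
      · rw [hqj a (by omega) (by omega), hqj (a + 1) (by omega) (by omega)]
        exact hp.adj a ha₁ ha₂
    have hqc : G.Adj (q (2 * k - 1)) (q 1) ∨ ¬ HasPathOfCard G (2 * k) := by
      rwa [hqj _ (by omega) (by omega), hqj _ (by omega) (by omega)]
    have hqfirst : ¬ G.Adj (q 0) (q 1) := by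
      intro hadj
      rcases hclosed with hc | hc
      · rw [hq0, hqj _ (by omega) (by omega)] at hadj
        -- the cycle `1, 2k - 1, …, i + 1, 0, 2, …, i`
        have := (((traverses_singleton G p 1).append
          (hp.down (a := i + 1) (by omega) (by omega) le_rfl) hc.symm
          (by simp; omega)).append (traverses_singleton G p 0) hb.symm
          (by simp; omega)).append
          (hp.up (a := 2) (b := i) (by omega) (by omega) (by omega)) h2 (by simp; omega)
        have hs : {1} ∪ Finset.Icc (i + 1) (2 * k - 1) ∪ {0} ∪ Finset.Icc 2 i =
            Finset.Icc 0 (2 * k - 1) := by ext; simp; omega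
        rw [hs] at this
        have := this.hasCycleOfCard (by simpa using hinj) hadj
        rw [Nat.card_Icc, show 2 * k - 1 + 1 - 0 = 2 * k by omega] at this
        exact hcycle this
      · have := hq.insert_end_hasPath (by omega) hqinj hadj
        rw [show 2 * k - 1 + 1 = 2 * k by omega] at this
        exact hc this
    have hqlast : ¬ G.Adj (q 0) (q (2 * k - 1)) := by
      intro hadj
      rcases hclosed with hc | hc
      · rw [hq0, hqj _ (by omega) (by omega)] at hadj
        -- the cycle `2k - 1, 1, …, i - 1, 0, 2k - 2, …, i`
        have := (((traverses_singleton G p (2 * k - 1)).append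
          (hp.up (a := 1) (b := i - 1) (by omega) (by omega) (by omega)) hc
          (by intro x; simp; omega)).append (traverses_singleton G p 0) ha.symm
          (by intro x; simp; omega)).append
          (hp.down (a := i) (b := 2 * k - 2) (by omega) (by omega) (by omega)) hN
          (by intro x; simp; omega)
        have hs : {2 * k - 1} ∪ Finset.Icc 1 (i - 1) ∪ {0} ∪ Finset.Icc i (2 * k - 2) =
            Finset.Icc 0 (2 * k - 1) := by ext; simp; omega
        rw [hs] at this
        have := this.hasCycleOfCard (by simpa using hinj) hadj
        rw [Nat.card_Icc, show 2 * k - 1 + 1 - 0 = 2 * k by omega] at this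
        exact hcycle this
      · have := hq.insert_last_hasPath (by omega) hqinj hadj
        rw [show 2 * k - 1 + 1 = 2 * k by omega] at this
        exact hc this
    have hall : ∀ j, 1 ≤ j → j ≤ 2 * k - 1 → (G.Adj (p i) (q j) ↔ Even j) := by
      intro j hj₁ hj
      rw [← hq0]
      exact IsIndexedPath.adj_zero_iff_even hV (hdeg _) hqinj hqfirst hqlast
        (hcons q hq hqinj hqc) hj₁ hj
    rcases Nat.eq_zero_or_pos j with rfl | hj₁
    · have := hall i (by omega) (by omega)
      rw [hqi] at this
      rw [this]
      constructor
      · rintro ⟨f, hf⟩; omega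
      · rintro ⟨h, -⟩; omega
    · by_cases hji : j = i
      · subst hji
        constructor
        · exact fun h' => absurd rfl h'.ne
        · rintro ⟨-, f, hf⟩; omega
      · rw [← hqj j (by omega) hji, hall j hj₁ hj]
        exact ⟨fun h' => ⟨hj₁, h'⟩, And.right⟩
  -- the positions of the vertices whose neighbours are those in the even positions
  set S : Finset ℕ := insert 0 ((Finset.Icc 1 (k - 2)).image fun j => 2 * j + 1) with hS
  set T : Finset ℕ := (Finset.Icc 1 (k - 1)).image fun j => 2 * j with hT
  have hSmem : ∀ i, i ∈ S ↔ i = 0 ∨ Odd i ∧ 3 ≤ i ∧ i ≤ 2 * k - 3 := by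
    intro i
    simp only [hS, Finset.mem_insert, Finset.mem_image, Finset.mem_Icc]
    refine or_congr_right ⟨?_, ?_⟩
    · rintro ⟨j, hj, rfl⟩
      exact ⟨⟨j, rfl⟩, by omega, by omega⟩
    · rintro ⟨⟨j, rfl⟩, h₁, h₂⟩
      exact ⟨j, by omega, rfl⟩
  have hTmem : ∀ i, i ∈ T ↔ Even i ∧ 1 ≤ i ∧ i ≤ 2 * k - 1 := by
    intro i
    simp only [hT, Finset.mem_image, Finset.mem_Icc]
    constructor
    · rintro ⟨j, hj, rfl⟩
      exact ⟨⟨j, by omega⟩, by omega, by omega⟩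
    · rintro ⟨⟨j, rfl⟩, h₁, h₂⟩
      exact ⟨j, by omega, by omega⟩
  have hSsub : ∀ i ∈ S, i ≤ 2 * k - 1 := fun i hi => by
    rcases (hSmem i).1 hi with rfl | h' <;> omega
  have hTsub : ∀ i ∈ T, i ≤ 2 * k - 1 := fun i hi => ((hTmem i).1 hi).2.2
  have hnotmem : ∀ (U : Finset ℕ), (∀ i ∈ U, i ≤ 2 * k - 1) → ∀ j, j ≤ 2 * k - 1 →
      (p j ∈ U.image p ↔ j ∈ U) := by
    intro U hU j hj
    rw [Finset.mem_image]
    constructor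
    · rintro ⟨i, hi, hij⟩
      rwa [← hinj ⟨by omega, hU i hi⟩ ⟨by omega, hj⟩ hij]
    · exact fun hj => ⟨j, hj, rfl⟩
  have hodd_last : Odd (2 * k - 1) := ⟨k - 1, by omega⟩
  refine inFamilyThree_of_split h hk htwo hdeg (W := S.image p) (A := T.image p)
    (p := p 1) (q := p (2 * k - 1)) ?_ ?_ ?_ ?_ ?_ ?_ ?_ ?_ ?_ ?_ (by omega)
  · rw [Finset.disjoint_left]
    intro v hv
    obtain ⟨i, hi, rfl⟩ := Finset.mem_image.1 hv
    rw [hnotmem T hTsub i (hSsub i hi), hTmem]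
    rcases (hSmem i).1 hi with rfl | ⟨⟨a, ha⟩, -⟩
    · omega
    · rintro ⟨⟨b, hb⟩, -⟩; omega
  · rw [hnotmem S hSsub _ (by omega), hSmem]; omega
  · rw [hnotmem S hSsub _ (by omega), hSmem]; omega
  · rw [hnotmem T hTsub _ (by omega), hTmem]; rintro ⟨⟨b, hb⟩, -⟩; omega
  · rw [hnotmem T hTsub _ (by omega), hTmem]; rintro ⟨⟨b, hb⟩, -⟩; omega
  · intro he
    have := hinj ⟨by omega, by omega⟩ ⟨by omega, le_rfl⟩ he
    omega
  · intro v
    obtain ⟨i, hi, rfl⟩ := exists_eq_of_injOn_Icc_zero hinj (by omega) v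
    rw [hnotmem S hSsub i hi, hnotmem T hTsub i hi, hSmem, hTmem]
    by_cases hi0 : i = 0
    · exact Or.inl (Or.inl hi0)
    rcases Nat.even_or_odd i with h' | h'
    · exact Or.inr (Or.inl ⟨h', by omega, hi⟩)
    · by_cases hi1 : i = 1
      · exact Or.inr (Or.inr (Or.inl (by rw [hi1])))
      by_cases hi2 : i = 2 * k - 1
      · exact Or.inr (Or.inr (Or.inr (by rw [hi2])))
      · refine Or.inl (Or.inr ⟨h', ?_⟩)
        obtain ⟨j, rfl⟩ := h'
        omega
  · rw [Finset.card_image_of_injOn (hinj.mono fun i hi => Set.mem_Icc.2 ⟨by omega, hSsub i hi⟩), hS,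
      Finset.card_insert_of_notMem (by simp),
      Finset.card_image_of_injective _ (fun a b hab => by simpa using hab)]
    simp; omega
  · rw [Finset.card_image_of_injOn (hinj.mono fun i hi => Set.mem_Icc.2 ⟨by omega, hTsub i hi⟩), hT,
      Finset.card_image_of_injective _ (fun a b hab => by simpa using hab)]
    simp
  · intro w hw v
    obtain ⟨i, hi, rfl⟩ := Finset.mem_image.1 hw
    obtain ⟨j, hj, rfl⟩ := exists_eq_of_injOn_Icc_zero hinj (by omega) v
    rw [hnotmem T hTsub j hj, hTmem]
    rcases (hSmem i).1 hi with rfl | ⟨h', h₁, h₂⟩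
    · rcases Nat.eq_zero_or_pos j with rfl | hj₁
      · simp
      · rw [hzero j hj₁ hj]
        exact ⟨fun h' => ⟨h', hj₁, hj⟩, And.left⟩
    · rw [hodd i h' h₁ h₂ j hj]
      tauto

/-- A cycle through all vertices but one puts a non-Hamiltonian `G` in `𝓕₃`. As the cycle has odd
length, it can be cut open between two vertices not adjacent to the missed vertex. -/
lemma HasCycleOfCard.inFamilyThree (h : IsPartnerMap c σ) (hV : Fintype.card V = 2 * k)
    (hk : Even k) (hk4 : 4 ≤ k) (htwo : ∀ i, {v | c v = i}.ncard = 2)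
    (hdeg : ∀ v, k - 1 ≤ G.degree v) (hcycle : ¬ HasCycleOfCard G (2 * k))
    (hcyc : HasCycleOfCard G (2 * k - 1)) : InFamilyThree c := by
  obtain ⟨p', hp', hc'⟩ := hcyc
  obtain ⟨p, hpp', hp, hinj⟩ := hp'.exists_off (by omega)
  have hc : G.Adj (p (2 * k - 1)) (p 1) := by
    rwa [hpp' _ (by omega), hpp' _ (by omega)]
  by_cases hends : ¬ G.Adj (p 0) (p 1) ∧ ¬ G.Adj (p 0) (p (2 * k - 1))
  · exact hp.inFamilyThree h hV hk hk4 htwo hdeg hcycle hinj (Or.inl hc) hends.1 hends.2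
  have hcons : ∀ i, 1 ≤ i → i < 2 * k - 1 → G.Adj (p 0) (p i) → ¬ G.Adj (p 0) (p (i + 1)) := by
    intro i hi₁ hi ha hb
    have := hp.insert_hasCycle hinj hc hi₁ hi ha hb
    rw [show 2 * k - 1 + 1 = 2 * k by omega] at this
    exact hcycle this
  have hends' : ¬ (G.Adj (p 0) (p 1) ∧ G.Adj (p 0) (p (2 * k - 1))) := by
    rintro ⟨ha, hb⟩
    have := ((traverses_singleton G p 0).append (hp.up le_rfl (by omega) le_rfl) ha
      (by simp)).hasCycleOfCard (by refine hinj.mono ?_; intro x; simp; omega) hb.symm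
    have hs : {0} ∪ Finset.Icc 1 (2 * k - 1) = Finset.Icc 0 (2 * k - 1) := by ext; simp; omega
    rw [hs, Nat.card_Icc, show 2 * k - 1 + 1 - 0 = 2 * k by omega] at this
    exact hcycle this
  obtain ⟨t, ht₁, ht, hta, htb⟩ : ∃ t, 1 ≤ t ∧ t < 2 * k - 1 ∧ ¬ G.Adj (p 0) (p t) ∧
      ¬ G.Adj (p 0) (p (t + 1)) := by
    by_contra! hno
    have halt : ∀ j, 2 * j + 1 ≤ 2 * k - 1 →
        (G.Adj (p 0) (p (2 * j + 1)) ↔ G.Adj (p 0) (p 1)) := by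
      intro j
      induction j with
      | zero => intro _; rfl
      | succ j ih =>
        intro hj
        rw [← ih (by omega)]
        have a₁ := hno (2 * j + 1) (by omega) (by omega)
        have a₂ := hno (2 * j + 2) (by omega) (by omega)
        have b₁ := hcons (2 * j + 1) (by omega) (by omega)
        have b₂ := hcons (2 * j + 2) (by omega) (by omega)
        rw [show 2 * (j + 1) + 1 = 2 * j + 2 + 1 by ring]
        constructor
        · intro h'; by_contra h''; exact b₂ (a₁ h'') h'
        · intro h'; exact a₂ (b₁ h')
    have := halt (k - 1) (by omega)
    rw [show 2 * (k - 1) + 1 = 2 * k - 1 by omega] at this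
    tauto
  obtain ⟨q', hq', hq1, hqN, hqr⟩ := ((hp.up (by omega) ht le_rfl).append
    (hp.up le_rfl ht₁ ht.le) hc (by simp; omega)).exists_isIndexedPath
      (hinj.mono (by intro x; simp; omega))
  have hs : Finset.Icc (t + 1) (2 * k - 1) ∪ Finset.Icc 1 t = Finset.Icc 1 (2 * k - 1) := by
    ext; simp; omega
  rw [hs, Nat.card_Icc, show 2 * k - 1 + 1 - 1 = 2 * k - 1 by omega] at hq' hqN hqr
  obtain ⟨q, hqq', hq, hqinj⟩ := hq'.exists_off (by omega)
  have hq0 : q 0 = p 0 := by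
    obtain ⟨i, hi, hpi⟩ := exists_eq_of_injOn_Icc_zero hinj (by omega) (q 0)
    rcases Nat.eq_zero_or_pos i with rfl | hi'
    · exact hpi.symm
    · obtain ⟨j, hj, hqj⟩ := (hqr (q 0)).2 ⟨i, by simp; omega, hpi⟩
      rw [← hqq' j hj.1] at hqj
      have := hqinj ⟨by omega, hj.2⟩ ⟨le_rfl, by omega⟩ hqj
      have := hj.1
      omega
  refine hq.inFamilyThree h hV hk hk4 htwo hdeg hcycle hqinj (Or.inl ?_) ?_ ?_
  · rw [hqq' _ (by omega), hqq' _ (by omega), hqN, hq1]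
    exact hp.adj t ht₁ ht
  · rw [hq0, hqq' _ (by omega), hq1]; exact htb
  · rw [hq0, hqq' _ (by omega), hqN]; exact hta

/-- A longest path through all vertices but one puts `G` in `𝓕₃`. -/
lemma HasPathOfCard.inFamilyThree (h : IsPartnerMap c σ) (hV : Fintype.card V = 2 * k)
    (hk : Even k) (hk4 : 4 ≤ k) (htwo : ∀ i, {v | c v = i}.ncard = 2)
    (hdeg : ∀ v, k - 1 ≤ G.degree v) (hcycle : ¬ HasCycleOfCard G (2 * k))
    (hpath : HasPathOfCard G (2 * k - 1)) (hmax : ¬ HasPathOfCard G (2 * k)) :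
    InFamilyThree c := by
  obtain ⟨p', hp'⟩ := hpath
  obtain ⟨p, -, hp, hinj⟩ := hp'.exists_off (by omega)
  have hsub : 2 * k - 1 + 1 = 2 * k := by omega
  refine hp.inFamilyThree h hV hk hk4 htwo hdeg hcycle hinj (Or.inr hmax) (fun ha => ?_)
    (fun ha => ?_)
  · exact hmax (hsub ▸ hp.insert_end_hasPath (by omega) hinj ha)
  · exact hmax (hsub ▸ hp.insert_last_hasPath (by omega) hinj ha)

end AlmostSpanning

/-! ### Longest paths -/

section LongestPath

variable {V : Type*} {G : SimpleGraph V} {p : ℕ → V} {k m : ℕ}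

/-- In a longest path of a graph, if the vertices of the path carry a cycle, no edge leaves them. -/
lemma IsIndexedPath.not_adj_of_closed (hp : IsIndexedPath G p m) (hclosed : G.Adj (p m) (p 1))
    (hmax : ¬ HasPathOfCard G (m + 1)) {i : ℕ} (h₁ : 1 ≤ i) (hi : i ≤ m) {w : V}
    (hw : ∀ i, 1 ≤ i → i ≤ m → p i ≠ w) : ¬ G.Adj (p i) w := by
  intro hadj
  obtain ⟨q, hq0, hqp, hq, hinj⟩ := hp.exists_zero_eq hw
  rw [← hq0, ← hqp i h₁] at hadj
  rw [← hqp 1 le_rfl, ← hqp m (by omega)] at hclosed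
  rcases hi.eq_or_lt with rfl | hi
  · exact hmax (hq.insert_last_hasPath h₁ hinj hadj.symm)
  · have h := ((hq.up (by omega) hi le_rfl).append (hq.up le_rfl h₁ hi.le) hclosed
      (by simp; omega)).append (traverses_singleton G q 0) hadj (by simp; omega)
    have := h.hasPathOfCard (hinj.mono (by intro x; simp; omega))
    have hs : Finset.Icc (i + 1) m ∪ Finset.Icc 1 i ∪ {0} = Finset.Icc 0 m := by
      ext; simp; omega
    rw [hs] at this
    exact hmax (by simpa using this)

variable [Fintype V] [DecidableRel G.Adj]

/-- The degree of a vertex is bounded by the number of possible positions of its neighbours. -/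
lemma degree_le_card_of_forall_adj {v : V} {P : Finset ℕ}
    (hP : ∀ w, G.Adj v w → ∃ i ∈ P, p i = w) : G.degree v ≤ P.card := by
  classical
  rw [← SimpleGraph.card_neighborFinset_eq_degree]
  refine (Finset.card_le_card (t := P.image p) fun w hw => ?_).trans Finset.card_image_le
  exact Finset.mem_image.2 (hP w (by simpa using hw))

lemma adj_of_card_le_degree {v : V} {P : Finset ℕ}
    (hP : ∀ w, G.Adj v w → ∃ i ∈ P, p i = w) (hcard : P.card ≤ G.degree v) {i : ℕ}
    (hi : i ∈ P) : G.Adj v (p i) := by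
  classical
  refine adj_of_forall_adj_mem (s := P.image p) (fun w hw => Finset.mem_image.2 (hP w hw))
    (Finset.card_image_le.trans hcard) (Finset.mem_image_of_mem p hi)

variable [DecidableEq V] {c : G.Coloring (Fin k)} {σ : V → V}

/-- A longest path with at most `2 * k - 1` vertices either carries a cycle, so that its vertices
form a component with `k` vertices, or has exactly `2 * k - 1` vertices. -/
lemma inFamily_or_hasPathOfCard (h : IsPartnerMap c σ) (hV : Fintype.card V = 2 * k)
    (hk : Even k) (hk4 : 4 ≤ k) (htwo : ∀ i, {v | c v = i}.ncard = 2)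
    (hdeg : ∀ v, k - 1 ≤ G.degree v) (hcycle : ¬ HasCycleOfCard G (2 * k)) :
    InFamilyOne c ∨ InFamilyThree c ∨ HasPathOfCard G (2 * k) := by
  by_cases hspan : HasPathOfCard G (2 * k)
  · exact Or.inr (Or.inr hspan)
  obtain ⟨m, hm, hmax⟩ : ∃ m, HasPathOfCard G m ∧ ¬ HasPathOfCard G (m + 1) := by
    by_contra! hno
    have : ∀ m, HasPathOfCard G m := by
      intro m
      induction m with
      | zero =>
        obtain ⟨v⟩ : Nonempty V := Fintype.card_pos_iff.1 (by omega)
        exact ⟨fun _ => v, by intro i hi; simp at hi, fun i _ hi => by omega⟩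
      | succ m ih => exact hno m ih
    exact hspan (this _)
  obtain ⟨p, hp⟩ := hm
  have hm2 : m < 2 * k := by
    by_contra! hge
    exact hspan ⟨p, hp.mono hge⟩
  have hm1 : 1 ≤ m := by
    by_contra! hlt
    obtain rfl : m = 0 := by omega
    obtain ⟨v⟩ : Nonempty V := Fintype.card_pos_iff.1 (by omega)
    exact hmax ⟨fun _ => v, by intro i hi j hj _; simp at hi hj; omega, fun i _ hi => by omega⟩
  have hfirst : ∀ w, G.Adj (p 1) w → ∃ i, 1 ≤ i ∧ i ≤ m ∧ p i = w := by
    intro w hadj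
    by_contra! hw
    obtain ⟨q, hq0, hqp, hq, hinj⟩ := hp.exists_zero_eq hw
    rw [← hq0, ← hqp 1 le_rfl] at hadj
    exact hmax (hq.insert_end_hasPath hm1 hinj hadj.symm)
  have hlast : ∀ w, G.Adj (p m) w → ∃ i, 1 ≤ i ∧ i ≤ m ∧ p i = w := by
    intro w hadj
    by_contra! hw
    obtain ⟨q, hq0, hqp, hq, hinj⟩ := hp.exists_zero_eq hw
    rw [← hq0, ← hqp m hm1] at hadj
    exact hmax (hq.insert_last_hasPath hm1 hinj hadj.symm)
  by_cases hcross : ∃ t, 1 ≤ t ∧ t < m ∧ G.Adj (p m) (p t) ∧ G.Adj (p 1) (p (t + 1))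
  · obtain ⟨t, ht₁, ht, hta, htb⟩ := hcross
    left
    have htr := (hp.up le_rfl ht₁ ht.le).append (hp.down (by omega) ht le_rfl) hta.symm
      (by simp; omega)
    have hs : Finset.Icc 1 t ∪ Finset.Icc (t + 1) m = Finset.Icc 1 m := by
      ext; simp; omega
    rw [hs] at htr
    obtain ⟨q, hq, hq1, hqm, -⟩ := htr.exists_isIndexedPath (by simpa using hp.injOn)
    rw [Nat.card_Icc, show m + 1 - 1 = m by omega] at hq hqm
    have hqc : G.Adj (q m) (q 1) := by rw [hq1, hqm]; exact htb.symm
    have hout : ∀ u ∈ (Finset.Icc 1 m).image q, ∀ v ∉ (Finset.Icc 1 m).image q,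
        ¬ G.Adj u v := by
      intro u hu v hv
      obtain ⟨i, hi, rfl⟩ := Finset.mem_image.1 hu
      rw [Finset.mem_Icc] at hi
      refine hq.not_adj_of_closed hqc hmax hi.1 hi.2 fun j h₁ h₂ he => hv ?_
      exact Finset.mem_image.2 ⟨j, by simp [h₁, h₂], he⟩
    have hAcard : ((Finset.Icc 1 m).image q).card = m := by
      rw [hq.card_image subset_rfl]; simp
    set A := (Finset.Icc 1 m).image q with hA
    have h1A : q 1 ∈ A := Finset.mem_image_of_mem q (by simp [hm1])
    have hdeg' : ∀ (s : Finset V) (v : V), v ∈ s → (∀ w, G.Adj v w → w ∈ s) → k ≤ s.card := by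
      intro s v hv hs
      have : (G.neighborFinset v).card ≤ (s.erase v).card :=
        Finset.card_le_card fun w hw => by
          have hw : G.Adj v w := by simpa using hw
          exact Finset.mem_erase.2 ⟨hw.ne.symm, hs w hw⟩
      rw [SimpleGraph.card_neighborFinset_eq_degree, Finset.card_erase_of_mem hv] at this
      have := hdeg v
      have := Finset.card_pos.2 ⟨v, hv⟩
      omega
    have hkm : k ≤ m := by
      rw [← hAcard]
      refine hdeg' A (q 1) h1A fun w hw => ?_
      by_contra hwA
      exact hout _ h1A w hwA hw
    have hcompl : k ≤ Aᶜ.card := by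
      obtain ⟨v, hv⟩ : ∃ v, v ∈ Aᶜ := by
        rw [← Finset.Nonempty, ← Finset.card_pos, Finset.card_compl]; omega
      refine hdeg' _ v hv fun w hw => ?_
      rw [Finset.mem_compl] at hv ⊢
      exact fun hwA => hout w hwA v hv hw.symm
    rw [Finset.card_compl] at hcompl
    exact inFamilyOne_of_card_eq h hV hdeg A (q 1) h1A (by omega)
      fun u hu _ v hv => hout u hu v hv
  · right; left
    push Not at hcross
    have hS : k - 1 ≤ ((Finset.Icc 1 (m - 1)).filter fun t => G.Adj (p 1) (p (t + 1))).card := by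
      refine (hdeg (p 1)).trans (degree_le_card_of_forall_adj (p := fun i => p (i + 1)) ?_)
      intro w hw
      obtain ⟨i, h₁, hi, rfl⟩ := hfirst w hw
      have hi1 : i ≠ 1 := by rintro rfl; exact hw.ne rfl
      have hi' : i - 1 + 1 = i := by omega
      refine ⟨i - 1, ?_, by rw [hi']⟩
      rw [Finset.mem_filter, Finset.mem_Icc, hi']
      exact ⟨by omega, hw⟩
    have hT : k - 1 ≤ ((Finset.Icc 1 (m - 1)).filter fun t => G.Adj (p m) (p t)).card := by
      refine (hdeg (p m)).trans (degree_le_card_of_forall_adj (p := p) ?_)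
      intro w hw
      obtain ⟨i, h₁, hi, rfl⟩ := hlast w hw
      have hi1 : i ≠ m := by rintro rfl; exact hw.ne rfl
      refine ⟨i, ?_, rfl⟩
      rw [Finset.mem_filter, Finset.mem_Icc]
      exact ⟨by omega, hw⟩
    have hdisj : Disjoint ((Finset.Icc 1 (m - 1)).filter fun t => G.Adj (p 1) (p (t + 1)))
        ((Finset.Icc 1 (m - 1)).filter fun t => G.Adj (p m) (p t)) := by
      rw [Finset.disjoint_left]
      intro t ht ht'
      rw [Finset.mem_filter, Finset.mem_Icc] at ht ht'
      exact hcross t (by omega) (by omega) ht'.2 ht.2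
    have hunion := Finset.card_le_card (Finset.union_subset
      (Finset.filter_subset (fun t => G.Adj (p 1) (p (t + 1))) (Finset.Icc 1 (m - 1)))
      (Finset.filter_subset (fun t => G.Adj (p m) (p t)) (Finset.Icc 1 (m - 1))))
    rw [Finset.card_union_of_disjoint hdisj, Nat.card_Icc] at hunion
    obtain rfl : m = 2 * k - 1 := by omega
    exact HasPathOfCard.inFamilyThree h hV hk hk4 htwo hdeg hcycle ⟨p, hp⟩ hspan

end LongestPath

/-! ### Hamiltonian paths whose ends do not cross -/

/-- A Hamiltonian path of a graph on `n` vertices that has neither a Hamiltonian cycle nor a cycle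
through all vertices but one. -/
structure IsExtremalPath {V : Type*} (G : SimpleGraph V) (p : ℕ → V) (n : ℕ) : Prop where
  path : IsIndexedPath G p n
  not_hasCycle : ¬ HasCycleOfCard G n
  not_hasCycle_sub_one : ¬ HasCycleOfCard G (n - 1)

namespace IsExtremalPath

section Cycles

variable {V : Type*} {G : SimpleGraph V} {p : ℕ → V} {n : ℕ}

lemma reflect (h : IsExtremalPath G p n) : IsExtremalPath G (fun i => p (n + 1 - i)) n :=
  ⟨h.path.reflect, h.not_hasCycle, h.not_hasCycle_sub_one⟩

/-- No cycle contains all positions, or all positions but `x`. -/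
lemma false_of_traverses (h : IsExtremalPath G p n) {a b : ℕ} {s : Finset ℕ}
    (ht : Traverses G p a b s) (hba : G.Adj (p b) (p a)) (hs : s ⊆ Finset.Icc 1 n) (x : ℕ)
    (hx : Finset.Icc 1 n ⊆ insert x s) : False := by
  have hcyc := ht.hasCycleOfCard (h.path.injOn.mono fun i hi => by simpa using hs hi) hba
  have h₁ := Finset.card_le_card hs
  have h₂ := (Finset.card_le_card hx).trans (Finset.card_insert_le _ _)
  rw [Nat.card_Icc] at h₁ h₂
  have : s.card = n ∨ s.card = n - 1 := by omega
  rcases this with h' | h'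
  · exact h.not_hasCycle (h' ▸ hcyc)
  · exact h.not_hasCycle_sub_one (h' ▸ hcyc)

/-- The cycle `1, …, t, n, …, s`, where `t < s ≤ t + 2`. -/
lemma not_adj_of_adj_last (h : IsExtremalPath G p n) {t s : ℕ} (ht : 1 ≤ t) (hts : t < s)
    (hst : s ≤ t + 2) (hs : s ≤ n) (ha : G.Adj (p n) (p t)) : ¬ G.Adj (p 1) (p s) := fun hb =>
  h.false_of_traverses ((h.path.up le_rfl ht (by omega)).append
    (h.path.down (by omega) hs le_rfl) ha.symm (by intro x; simp; omega)) hb.symm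
    (by intro x; simp; omega) (t + 1) (by intro x; simp; omega)

/-- The cycle `1, …, n - 1` or `1, …, n`. -/
lemma lt_of_adj_first (h : IsExtremalPath G p n) {s : ℕ} (hn : 2 ≤ n) (hs : s ≤ n)
    (ha : G.Adj (p 1) (p s)) : s < n - 1 := by
  by_contra! hlt
  have hs0 : 1 ≤ s := by omega
  exact h.false_of_traverses (h.path.up le_rfl hs0 hs) ha.symm (by intro x; simp; omega) n
    (by intro x; simp; omega)

/-- The cycle `2, …, n` or `1, …, n`. -/
lemma lt_of_adj_last (h : IsExtremalPath G p n) {s : ℕ} (hn : 2 ≤ n) (hs : 1 ≤ s)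
    (ha : G.Adj (p n) (p s)) : 2 < s := by
  by_contra! hlt
  exact h.false_of_traverses (h.path.up hs (by omega) le_rfl) ha (by intro x; simp; omega) 1
    (by intro x; simp; omega)

/-- The cycle `i, …, 1, i', …, j', n, …, j`, which misses at most one vertex. -/
lemma not_adj_of_adj_ends (h : IsExtremalPath G p n) {i i' j' j : ℕ} (hi : 1 ≤ i) (hii' : i < i')
    (hij : i' ≤ j') (hjj' : j' < j) (hj : j ≤ n) (hmiss : i' + j ≤ i + j' + 3)
    (ha : G.Adj (p 1) (p i')) (hb : G.Adj (p n) (p j')) : ¬ G.Adj (p i) (p j) := fun hadj =>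
  h.false_of_traverses (((h.path.down le_rfl hi (by omega)).append
    (h.path.up (by omega) hij (by omega)) ha (by intro x; simp; omega)).append
    (h.path.down (by omega) hj le_rfl) hb.symm (by intro x; simp; omega)) hadj.symm
    (by intro x; simp; omega) (if i' = i + 1 then j' + 1 else i + 1)
    (by intro x; split_ifs <;> simp <;> omega)

/-- The cycle `t, …, 1, u + 1, …, n, s, …, u`, where `t < s ≤ t + 2`. -/
lemma not_adj_of_adj_succ (h : IsExtremalPath G p n) {t s u : ℕ} (ht : 1 ≤ t) (hts : t < s)
    (hst : s ≤ t + 2) (hsu : s ≤ u) (hu : u < n)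
    (ha : G.Adj (p 1) (p (u + 1))) (hb : G.Adj (p n) (p s)) : ¬ G.Adj (p t) (p u) := fun hadj =>
  h.false_of_traverses (((h.path.down le_rfl ht (by omega)).append
    (h.path.up (by omega) hu le_rfl) ha (by intro x; simp; omega)).append
    (h.path.up (by omega) hsu hu.le) hb (by intro x; simp; omega)) hadj.symm
    (by intro x; simp; omega) (t + 1) (by intro x; simp; omega)

/-- The cycle `i, …, 1, i + 1, …, l, j, …, n, j - 1, …, l + 1`. -/
lemma not_adj_of_adj_cross (h : IsExtremalPath G p n) {i l j : ℕ} (hi : 1 ≤ i) (hil : i < l)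
    (hlj : l + 1 < j) (hj : j ≤ n) (ha : G.Adj (p 1) (p (i + 1)))
    (hb : G.Adj (p n) (p (j - 1))) (hc : G.Adj (p l) (p j)) : ¬ G.Adj (p i) (p (l + 1)) :=
  fun hadj => h.false_of_traverses ((((h.path.down le_rfl hi (by omega)).append
    (h.path.up (by omega) hil (by omega)) ha (by intro x; simp; omega)).append
    (h.path.up (by omega) hj le_rfl) hc (by intro x; simp; omega)).append
    (h.path.down (a := l + 1) (b := j - 1) (by omega) (by omega) (by omega)) hb
      (by intro x; simp; omega)) hadj.symm
    (by intro x; simp; omega) 1 (by intro x; simp; omega)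

/-- The cycle `s + 1, …, u, 1, …, s, u + 1, …, n`. -/
lemma not_adj_of_adj_insert (h : IsExtremalPath G p n) {s u : ℕ} (hs : 1 ≤ s) (hsu : s < u)
    (hu : u < n) (ha : G.Adj (p 1) (p u)) (hb : G.Adj (p n) (p (s + 1))) :
    ¬ G.Adj (p s) (p (u + 1)) := fun hadj =>
  h.false_of_traverses (((h.path.up (by omega) hsu hu.le).append
    (h.path.up le_rfl hs (by omega)) ha.symm (by intro x; simp; omega)).append
    (h.path.up (by omega) hu le_rfl) hadj (by intro x; simp; omega)) hb
    (by intro x; simp; omega) 1 (by intro x; simp; omega)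

lemma exists_eq [Fintype V] {k : ℕ} (h : IsExtremalPath G p (2 * k)) (hV : Fintype.card V = 2 * k)
    (v : V) : ∃ i, 1 ≤ i ∧ i ≤ 2 * k ∧ p i = v := by
  have hp := h.path
  rw [← hV] at hp ⊢
  exact hp.exists_eq v

end Cycles

end IsExtremalPath

section Extremal

variable {V : Type*} [Fintype V] {G : SimpleGraph V} [DecidableRel G.Adj]
  {p : ℕ → V} {k : ℕ} {c : G.Coloring (Fin k)} {σ : V → V}

/-- `degree_le_card_of_forall_adj` for a path through all vertices. -/
lemma IsExtremalPath.degree_le (h : IsExtremalPath G p (2 * k)) (hV : Fintype.card V = 2 * k)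
    {v : V} (P : Finset ℕ) (hP : ∀ i, 1 ≤ i → i ≤ 2 * k → G.Adj v (p i) → i ∈ P) :
    G.degree v ≤ P.card := by
  refine degree_le_card_of_forall_adj (p := p) fun w hw => ?_
  obtain ⟨i, h₁, hi, rfl⟩ := h.exists_eq hV w
  exact ⟨i, hP i h₁ hi hw, rfl⟩

lemma IsExtremalPath.adj_of_card_le (h : IsExtremalPath G p (2 * k))
    (hV : Fintype.card V = 2 * k) {v : V} (P : Finset ℕ)
    (hP : ∀ i, 1 ≤ i → i ≤ 2 * k → G.Adj v (p i) → i ∈ P) (hcard : P.card ≤ G.degree v) {i : ℕ}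
    (hi : i ∈ P) : G.Adj v (p i) := by
  refine adj_of_card_le_degree (p := p) (fun w hw => ?_) hcard hi
  obtain ⟨i, h₁, hi, rfl⟩ := h.exists_eq hV w
  exact ⟨i, hP i h₁ hi hw, rfl⟩

variable [DecidableEq V]

/-- Half of a Hamiltonian path, joined to the rest by edges at a single vertex, gives `𝓕₁`. -/
lemma IsExtremalPath.inFamilyOne_of_half (h : IsExtremalPath G p (2 * k))
    (hσ : IsPartnerMap c σ) (hV : Fintype.card V = 2 * k) (hdeg : ∀ v, k - 1 ≤ G.degree v)
    {P : Finset ℕ} (hP : P ⊆ Finset.Icc 1 (2 * k)) (hcard : P.card = k) {z : ℕ} (hz : z ∈ P)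
    (hcut : ∀ i ∈ P, i ≠ z → ∀ j, 1 ≤ j → j ≤ 2 * k → j ∉ P → ¬ G.Adj (p i) (p j)) :
    InFamilyOne c := by
  refine inFamilyOne_of_card_eq hσ hV hdeg (P.image p) (p z) (Finset.mem_image_of_mem p hz)
    (by rw [h.path.card_image hP, hcard]) fun u hu huz v hv => ?_
  obtain ⟨i, hi, rfl⟩ := Finset.mem_image.1 hu
  obtain ⟨j, hj₁, hj, rfl⟩ := h.exists_eq hV v
  exact hcut i hi (fun he => huz (by rw [he])) j hj₁ hj
    fun hjP => hv (Finset.mem_image_of_mem p hjP)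

/-- Suppose that the last vertex is adjacent to the whole second half, and that the neighbours of the
first one lie in `[2, k + 1]` and include `k + 1`. By the degree condition they miss at most one
position in `[2, k + 1]`, and `k + 1` separates the second half from the first. -/
lemma IsExtremalPath.inFamilyOne_of_last (h : IsExtremalPath G p (2 * k))
    (hσ : IsPartnerMap c σ) (hV : Fintype.card V = 2 * k) (hk4 : 4 ≤ k)
    (hdeg : ∀ v, k - 1 ≤ G.degree v)
    (hfirst : ∀ i, 1 ≤ i → i ≤ 2 * k → G.Adj (p 1) (p i) → i ≤ k + 1)
    (hmid : G.Adj (p 1) (p (k + 1)))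
    (hlast : ∀ i, k + 1 ≤ i → i ≤ 2 * k - 1 → G.Adj (p (2 * k)) (p i)) : InFamilyOne c := by
  have hor : ∀ t, 1 ≤ t → t ≤ k → G.Adj (p 1) (p (t + 1)) ∨
      (G.Adj (p 1) (p (t + 2)) ∧ t < k) := by
    intro t ht₁ ht
    rcases ht.eq_or_lt with rfl | ht
    · exact Or.inl hmid
    by_contra! hno
    have hcard := h.degree_le hV (v := p 1) (((Finset.Icc 2 (k + 1)).erase (t + 1)).erase (t + 2))
      (fun i h₁ hi hadj => by
        have := hfirst i h₁ hi hadj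
        have hi1 : i ≠ 1 := by rintro rfl; exact hadj.ne rfl
        have hit : i ≠ t + 1 := by rintro rfl; exact hno.1 hadj
        have hit' : i ≠ t + 2 := by rintro rfl; exact absurd ht (by have := hno.2 hadj; omega)
        simp; omega)
    rw [Finset.card_erase_of_mem (by simp; omega), Finset.card_erase_of_mem (by simp; omega),
      Nat.card_Icc] at hcard
    have := hdeg (p 1)
    omega
  refine h.inFamilyOne_of_half hσ hV hdeg (P := Finset.Icc (k + 1) (2 * k)) (z := k + 1)
    (by intro x; simp; omega) (by simp; omega) (by simp; omega) ?_
  intro i hi hik j hj₁ hj hjP hadj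
  rw [Finset.mem_Icc] at hi hjP
  have hlast' := hlast (i - 1) (by omega) (by omega)
  rcases hor j hj₁ (by omega) with ha | ⟨ha, hjk⟩
  · exact h.not_adj_of_adj_ends hj₁ (by omega) (by omega) (by omega) hi.2 (by omega) ha hlast'
      hadj.symm
  · exact h.not_adj_of_adj_ends hj₁ (by omega) (by omega) (by omega) hi.2 (by omega) ha hlast'
      hadj.symm

/-- If each end of the path is adjacent to the whole half of the path that it lies in, then all edges
between the halves contain the vertex in position `k` or `k + 1`, and by `not_adj_of_adj_cross` one
of these two vertices suffices. -/
lemma IsExtremalPath.inFamilyOne_of_gap (h : IsExtremalPath G p (2 * k))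
    (hσ : IsPartnerMap c σ) (hV : Fintype.card V = 2 * k) (hk4 : 4 ≤ k)
    (hdeg : ∀ v, k - 1 ≤ G.degree v)
    (hfirst : ∀ i, 2 ≤ i → i ≤ k → G.Adj (p 1) (p i))
    (hlast : ∀ i, k + 1 ≤ i → i ≤ 2 * k - 1 → G.Adj (p (2 * k)) (p i)) : InFamilyOne c := by
  have hends : ∀ i, 1 ≤ i → i < k → ∀ j, k + 2 ≤ j → j ≤ 2 * k → ¬ G.Adj (p i) (p j) := by
    intro i hi₁ hi j hj₁ hj
    exact h.not_adj_of_adj_ends (i' := i + 1) (j' := j - 1) hi₁ (by omega) (by omega) (by omega)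
      hj (by omega) (hfirst _ (by omega) (by omega)) (hlast _ (by omega) (by omega))
  by_cases hex : ∃ j, k + 2 ≤ j ∧ j ≤ 2 * k ∧ G.Adj (p k) (p j)
  · obtain ⟨j, hj₁, hj, hadj⟩ := hex
    refine h.inFamilyOne_of_half hσ hV hdeg (P := Finset.Icc 1 k) (z := k)
      (by intro x; simp; omega) (by simp) (by simp; omega) ?_
    intro i hi hik l hl₁ hl hlP
    rw [Finset.mem_Icc] at hi hlP
    by_cases hlk : l = k + 1
    · rw [hlk]
      exact h.not_adj_of_adj_cross hi.1 (by omega) hj₁ hj (hfirst _ (by omega) (by omega))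
        (hlast _ (by omega) (by omega)) hadj
    · exact hends i hi.1 (by omega) l (by omega) hl
  · push Not at hex
    refine h.inFamilyOne_of_half hσ hV hdeg (P := Finset.Icc (k + 1) (2 * k)) (z := k + 1)
      (by intro x; simp; omega) (by simp; omega) (by simp; omega) ?_
    intro i hi hik l hl₁ hl hlP hadj
    rw [Finset.mem_Icc] at hi hlP
    by_cases hlk : l = k
    · rw [hlk] at hadj
      exact hex i (by omega) hi.2 hadj.symm
    · exact hends l hl₁ (by omega) i (by omega) hi.2 hadj.symm

/-- If no neighbour of the first vertex comes after a neighbour of the last one, then by the degree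
condition these neighbours fill the two halves of the path up to at most one position. -/
lemma IsExtremalPath.inFamilyOne_of_not_cross (h : IsExtremalPath G p (2 * k))
    (hσ : IsPartnerMap c σ) (hV : Fintype.card V = 2 * k) (hk4 : 4 ≤ k)
    (hdeg : ∀ v, k - 1 ≤ G.degree v)
    (hcross : ∀ i j, 1 ≤ i → i < j → j ≤ 2 * k → G.Adj (p (2 * k)) (p i) →
      ¬ G.Adj (p 1) (p j)) : InFamilyOne c := by
  have hfirst2 : G.Adj (p 1) (p 2) := h.path.adj 1 le_rfl (by omega)
  have hlast2 : G.Adj (p (2 * k)) (p (2 * k - 1)) := by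
    have := h.path.adj (2 * k - 1) (by omega) (by omega)
    rw [show 2 * k - 1 + 1 = 2 * k by omega] at this
    exact this.symm
  have hbound : ∀ i, 1 ≤ i → i ≤ 2 * k → G.Adj (p 1) (p i) → ∀ j, 1 ≤ j → j ≤ 2 * k →
      G.Adj (p (2 * k)) (p j) → i ≤ j := by
    intro i hi₁ hi ha j hj₁ hj hb
    by_contra! hlt
    exact hcross j i hj₁ hlt hi hb ha
  -- the last neighbour of the first vertex is in position `k` or `k + 1`
  obtain ⟨M, hM1, hM2, hMadj, hMmax⟩ : ∃ M, 2 ≤ M ∧ M ≤ 2 * k ∧ G.Adj (p 1) (p M) ∧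
      ∀ i, 1 ≤ i → i ≤ 2 * k → G.Adj (p 1) (p i) → i ≤ M := by
    have hne : ((Finset.Icc 2 (2 * k)).filter fun i => G.Adj (p 1) (p i)).Nonempty :=
      ⟨2, by simp [hfirst2]; omega⟩
    have hmem := Finset.max'_mem _ hne
    rw [Finset.mem_filter, Finset.mem_Icc] at hmem
    refine ⟨_, hmem.1.1, hmem.1.2, hmem.2, fun i h₁ hi hadj => Finset.le_max' _ _ ?_⟩
    have hi1 : i ≠ 1 := by rintro rfl; exact hadj.ne rfl
    simp [hadj]; omega
  obtain ⟨m, hm1, hm2, hmadj, hmmin⟩ : ∃ m, 1 ≤ m ∧ m ≤ 2 * k - 1 ∧ G.Adj (p (2 * k)) (p m) ∧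
      ∀ i, 1 ≤ i → i ≤ 2 * k → G.Adj (p (2 * k)) (p i) → m ≤ i := by
    have hne : ((Finset.Icc 1 (2 * k - 1)).filter fun i => G.Adj (p (2 * k)) (p i)).Nonempty :=
      ⟨2 * k - 1, by simp [hlast2]; omega⟩
    have hmem := Finset.min'_mem _ hne
    rw [Finset.mem_filter, Finset.mem_Icc] at hmem
    refine ⟨_, hmem.1.1, hmem.1.2, hmem.2, fun i h₁ hi hadj => Finset.min'_le _ _ ?_⟩
    have hi1 : i ≠ 2 * k := by rintro rfl; exact hadj.ne rfl
    simp [hadj]; omega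
  have hMm := hbound M (by omega) hM2 hMadj m hm1 (by omega) hmadj
  have hN1 : ∀ i, 1 ≤ i → i ≤ 2 * k → G.Adj (p 1) (p i) → i ∈ Finset.Icc 2 M := by
    intro i h₁ hi hadj
    have hi1 : i ≠ 1 := by rintro rfl; exact hadj.ne rfl
    have := hMmax i h₁ hi hadj
    simp; omega
  have hNn : ∀ i, 1 ≤ i → i ≤ 2 * k → G.Adj (p (2 * k)) (p i) →
      i ∈ Finset.Icc m (2 * k - 1) := by
    intro i h₁ hi hadj
    have hi1 : i ≠ 2 * k := by rintro rfl; exact hadj.ne rfl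
    have := hmmin i h₁ hi hadj
    simp; omega
  have hd1 := (hdeg (p 1)).trans (h.degree_le hV _ hN1)
  have hdn := (hdeg (p (2 * k))).trans (h.degree_le hV _ hNn)
  rw [Nat.card_Icc] at hd1 hdn
  have hfirst : M = k → ∀ i, 2 ≤ i → i ≤ k → G.Adj (p 1) (p i) := by
    rintro rfl i h₂ hi
    refine h.adj_of_card_le hV _ hN1 ?_ (by simp; omega)
    have := hdeg (p 1)
    simp; omega
  have hlast : m = k + 1 → ∀ i, k + 1 ≤ i → i ≤ 2 * k - 1 → G.Adj (p (2 * k)) (p i) := by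
    rintro rfl i h₂ hi
    refine h.adj_of_card_le hV _ hNn ?_ (by simp; omega)
    have := hdeg (p (2 * k))
    simp; omega
  have hcases : M = k ∧ m = k + 1 ∨ M = k + 1 ∧ m = k + 1 ∨ M = k ∧ m = k := by omega
  rcases hcases with ⟨hM, hm⟩ | ⟨hM, hm⟩ | ⟨hM, hm⟩
  · exact h.inFamilyOne_of_gap hσ hV hk4 hdeg (hfirst hM) (hlast hm)
  · refine h.inFamilyOne_of_last hσ hV hk4 hdeg ?_ (hM ▸ hMadj) (hlast hm)
    exact fun i h₁ hi hadj => hM ▸ hMmax i h₁ hi hadj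
  · refine h.reflect.inFamilyOne_of_last hσ hV hk4 hdeg ?_ ?_ ?_
    · intro i h₁ hi hadj
      rw [show 2 * k + 1 - 1 = 2 * k by omega] at hadj
      have := hmmin _ (by omega) (by omega) hadj
      omega
    · rw [show 2 * k + 1 - 1 = 2 * k by omega, show 2 * k + 1 - (k + 1) = k by omega]
      exact hm ▸ hmadj
    · intro i h₁ hi
      rw [show 2 * k + 1 - 2 * k = 1 by omega]
      exact hfirst hM _ (by omega) (by omega)

end Extremal

/-! ### Hamiltonian paths with interlaced ends -/

/-- The neighbours of the first vertex of a path on `n` vertices are those in the positions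
`[2, a] ∪ [b + 3, e]`, the neighbours of the last vertex those in `[a, b] ∪ [e, n - 1]`. -/
structure HasInterlacedEnds {V : Type*} (G : SimpleGraph V) (p : ℕ → V) (n a b e : ℕ) : Prop where
  three_le : 3 ≤ a
  le_mid : a ≤ b
  mid_le : b + 3 ≤ e
  le_sub : e + 2 ≤ n
  first : ∀ i, 1 ≤ i → i ≤ n → (G.Adj (p 1) (p i) ↔ 2 ≤ i ∧ i ≤ a ∨ b + 3 ≤ i ∧ i ≤ e)
  last : ∀ i, 1 ≤ i → i ≤ n → (G.Adj (p n) (p i) ↔ a ≤ i ∧ i ≤ b ∨ e ≤ i ∧ i ≤ n - 1)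

section Interlaced

variable {V : Type*} {G : SimpleGraph V} {p : ℕ → V}

lemma HasInterlacedEnds.reflect {n a b e : ℕ} (h : HasInterlacedEnds G p n a b e) :
    HasInterlacedEnds G (fun i => p (n + 1 - i)) n (n + 1 - e) (n - 2 - b) (n + 1 - a) := by
  obtain ⟨h₁, h₂, h₃, h₄, hf, hl⟩ := h
  refine ⟨by omega, by omega, by omega, by omega, fun i hi₁ hi => ?_, fun i hi₁ hi => ?_⟩
  · rw [show n + 1 - 1 = n by omega, hl _ (by omega) (by omega)]
    omega
  · rw [show n + 1 - n = 1 by omega, hf _ (by omega) (by omega)]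
    omega

variable [Fintype V] [DecidableRel G.Adj] {k : ℕ} {c : G.Coloring (Fin k)}
  {σ : V → V}

/-- Consider a neighbour `i` of the last vertex and a later neighbour `j` of the first one at
minimal distance. The positions between them do not contribute to the degrees of the ends, which
forces `j = i + 3`, and for every other `t` exactly one of the edges from the first vertex to
`t + 1` and from the last vertex to `t` is present. -/
lemma IsExtremalPath.exists_hasInterlacedEnds (h : IsExtremalPath G p (2 * k))
    (hV : Fintype.card V = 2 * k) (hk4 : 4 ≤ k) (hdeg : ∀ v, k - 1 ≤ G.degree v)
    (hcross : ∃ i j, 1 ≤ i ∧ i < j ∧ j ≤ 2 * k ∧ G.Adj (p (2 * k)) (p i) ∧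
      G.Adj (p 1) (p j)) : ∃ a b e, HasInterlacedEnds G p (2 * k) a b e := by
  classical
  have hex : ∃ d, ∃ i, 1 ≤ i ∧ 1 ≤ d ∧ i + d ≤ 2 * k ∧ G.Adj (p (2 * k)) (p i) ∧
      G.Adj (p 1) (p (i + d)) := by
    obtain ⟨i, j, hi, hij, hj, ha, hb⟩ := hcross
    exact ⟨j - i, i, hi, by omega, by omega, ha, by rwa [show i + (j - i) = j by omega]⟩
  obtain ⟨b, hb₁, hd, hbd, hbadj, hbdadj⟩ := Nat.find_spec hex
  have hmin := fun d' hd' => Nat.find_min hex (m := d') hd'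
  set d := Nat.find hex with hddef
  clear_value d
  -- no position strictly between is adjacent to an end
  have hbetween : ∀ i, b < i → i < b + d → ¬ G.Adj (p 1) (p i) ∧ ¬ G.Adj (p (2 * k)) (p i) := by
    intro i hi₁ hi
    constructor
    · intro hadj
      refine hmin (i - b) (by omega) ⟨b, hb₁, by omega, by omega, hbadj, ?_⟩
      rwa [show b + (i - b) = i by omega]
    · intro hadj
      refine hmin (b + d - i) (by omega) ⟨i, by omega, by omega, by omega, hadj, ?_⟩
      rwa [show i + (b + d - i) = b + d by omega]
  have hd3 : 3 ≤ d := by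
    by_contra! hlt
    exact h.not_adj_of_adj_last hb₁ (by omega) (by omega) hbd hbadj hbdadj
  set S := (Finset.Icc 1 (2 * k - 1)).filter fun t => G.Adj (p 1) (p (t + 1)) with hS
  set T := (Finset.Icc 1 (2 * k - 1)).filter fun t => G.Adj (p (2 * k)) (p t) with hT
  have hScard : k - 1 ≤ S.card := by
    refine (hdeg (p 1)).trans (degree_le_card_of_forall_adj (p := fun i => p (i + 1)) ?_)
    intro w hw
    obtain ⟨i, h₁, hi, rfl⟩ := h.exists_eq hV w
    have hi1 : i ≠ 1 := by rintro rfl; exact hw.ne rfl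
    have hi' : i - 1 + 1 = i := by omega
    refine ⟨i - 1, ?_, by rw [hi']⟩
    rw [hS, Finset.mem_filter, Finset.mem_Icc, hi']
    exact ⟨by omega, hw⟩
  have hTcard : k - 1 ≤ T.card := by
    refine (hdeg (p (2 * k))).trans (h.degree_le hV _ fun i h₁ hi hw => ?_)
    have hi1 : i ≠ 2 * k := by rintro rfl; exact hw.ne rfl
    rw [hT, Finset.mem_filter, Finset.mem_Icc]
    exact ⟨by omega, hw⟩
  have hdisj : Disjoint S T := by
    rw [Finset.disjoint_left]
    intro t ht ht'
    rw [hS, Finset.mem_filter, Finset.mem_Icc] at ht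
    rw [hT, Finset.mem_filter] at ht'
    exact h.not_adj_of_adj_last ht.1.1 (by omega) (by omega) (by omega) ht'.2 ht.2
  have hsub : S ∪ T ⊆ Finset.Icc 1 (2 * k - 1) \ Finset.Icc (b + 1) (b + d - 2) := by
    intro t ht
    rw [Finset.mem_sdiff]
    rw [Finset.mem_union, hS, hT, Finset.mem_filter, Finset.mem_filter] at ht
    refine ⟨by tauto, fun htb => ?_⟩
    rw [Finset.mem_Icc] at htb
    rcases ht with ht | ht
    · exact (hbetween (t + 1) (by omega) (by omega)).1 ht.2
    · exact (hbetween t (by omega) (by omega)).2 ht.2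
  have hsdiff : (Finset.Icc 1 (2 * k - 1) \ Finset.Icc (b + 1) (b + d - 2)).card =
      2 * k - 1 - (d - 2) := by
    rw [Finset.card_sdiff_of_subset (by intro x; simp; omega)]
    simp; omega
  have hle := Finset.card_le_card hsub
  rw [hsdiff, Finset.card_union_of_disjoint hdisj] at hle
  obtain rfl : d = 3 := by omega
  have hST : S ∪ T = Finset.Icc 1 (2 * k - 1) \ Finset.Icc (b + 1) (b + 3 - 2) := by
    refine Finset.eq_of_subset_of_card_le hsub ?_
    rw [hsdiff, Finset.card_union_of_disjoint hdisj]
    omega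
  have hor : ∀ t, 1 ≤ t → t ≤ 2 * k - 1 → t ≠ b + 1 →
      G.Adj (p 1) (p (t + 1)) ∨ G.Adj (p (2 * k)) (p t) := by
    intro t ht₁ ht htb
    have : t ∈ S ∪ T := by rw [hST]; simp; omega
    rw [Finset.mem_union, hS, hT, Finset.mem_filter, Finset.mem_filter] at this
    tauto
  have hup : ∀ t, 1 ≤ t → t ≠ b → t + 2 ≤ 2 * k → G.Adj (p (2 * k)) (p t) →
      G.Adj (p (2 * k)) (p (t + 1)) := by
    intro t ht₁ htb ht hadj
    exact (hor (t + 1) (by omega) (by omega) (by omega)).resolve_left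
      (h.not_adj_of_adj_last ht₁ (by omega) (by omega) (by omega) hadj)
  have hdown : ∀ t, 2 ≤ t → t ≠ b + 2 → t + 1 ≤ 2 * k → G.Adj (p 1) (p (t + 1)) →
      G.Adj (p 1) (p t) := by
    intro t ht₁ htb ht hadj
    have := hor (t - 1) (by omega) (by omega) (by omega)
    rw [show t - 1 + 1 = t by omega] at this
    exact this.resolve_right fun ha =>
      h.not_adj_of_adj_last (by omega) (by omega) (by omega) ht ha hadj
  -- `a` is the first neighbour of the last vertex, `e` the last neighbour of the first vertex
  obtain ⟨a, ha₁, hab, haadj, hamin⟩ : ∃ a, 1 ≤ a ∧ a ≤ b ∧ G.Adj (p (2 * k)) (p a) ∧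
      ∀ i, 1 ≤ i → i < a → ¬ G.Adj (p (2 * k)) (p i) := by
    have hne : ∃ a, 1 ≤ a ∧ G.Adj (p (2 * k)) (p a) := ⟨b, hb₁, hbadj⟩
    refine ⟨Nat.find hne, (Nat.find_spec hne).1, Nat.find_min' hne ⟨hb₁, hbadj⟩,
      (Nat.find_spec hne).2, fun i hi₁ hi hadj => Nat.find_min hne hi ⟨hi₁, hadj⟩⟩
  obtain ⟨e, he₁, he, headj, hemax⟩ : ∃ e, b + 3 ≤ e ∧ e ≤ 2 * k ∧ G.Adj (p 1) (p e) ∧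
      ∀ i, e < i → i ≤ 2 * k → ¬ G.Adj (p 1) (p i) := by
    have hne : ((Finset.Icc (b + 3) (2 * k)).filter fun i => G.Adj (p 1) (p i)).Nonempty :=
      ⟨b + 3, by simp [hbdadj]; omega⟩
    have hmem := Finset.max'_mem _ hne
    rw [Finset.mem_filter, Finset.mem_Icc] at hmem
    refine ⟨_, hmem.1.1, hmem.1.2, hmem.2, fun i hlt hi hadj => ?_⟩
    refine absurd (Finset.le_max' _ i ?_) (not_le.2 hlt)
    rw [Finset.mem_filter, Finset.mem_Icc]
    exact ⟨⟨by omega, hi⟩, hadj⟩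
  have ha3 := h.lt_of_adj_last (by omega) ha₁ haadj
  have hen := h.lt_of_adj_first (by omega) he headj
  have hlastab : ∀ i, a ≤ i → i ≤ b → G.Adj (p (2 * k)) (p i) := by
    intro i hi
    induction i, hi using Nat.le_induction with
    | base => exact fun _ => haadj
    | succ i hi ih => exact fun hib => hup i (by omega) (by omega) (by omega) (ih (by omega))
  have hfirstbe : ∀ j i, i + j = e → b + 3 ≤ i → G.Adj (p 1) (p i) := by
    intro j
    induction j with
    | zero => rintro i rfl _; exact headj
    | succ j ih =>
      intro i hi hbi
      exact hdown i (by omega) (by omega) (by omega) (ih (i + 1) (by omega) (by omega))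
  refine ⟨a, b, e, ha3, hab, he₁, by omega, fun i hi₁ hi => ⟨fun hadj => ?_, ?_⟩,
    fun i hi₁ hi => ⟨fun hadj => ?_, ?_⟩⟩
  · have hi1 : i ≠ 1 := by rintro rfl; exact hadj.ne rfl
    by_contra hno
    have hie : i ≤ e := by
      by_contra! hlt
      exact hemax i hlt hi hadj
    by_cases hib : i ≤ b + 1
    · refine h.not_adj_of_adj_last (t := i - 1) (by omega) (by omega) (by omega) hi
        (hlastab _ (by omega) (by omega)) hadj
    · exact (hbetween i (by omega) (by omega)).1 hadj
  · rintro (⟨h₁, h₂⟩ | ⟨h₁, h₂⟩)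
    · have := hor (i - 1) (by omega) (by omega) (by omega)
      rw [show i - 1 + 1 = i by omega] at this
      exact this.resolve_right (hamin _ (by omega) (by omega))
    · exact hfirstbe (e - i) i (by omega) h₁
  · have hi1 : i ≠ 2 * k := by rintro rfl; exact hadj.ne rfl
    by_contra hno
    have hie : a ≤ i := by
      by_contra! hlt
      exact hamin i hi₁ hlt hadj
    by_cases hib : i < b + 3
    · exact (hbetween i (by omega) (by omega)).2 hadj
    · exact h.not_adj_of_adj_last (s := i + 1) hi₁ (by omega) (by omega) (by omega) hadj
        (hfirstbe (e - (i + 1)) _ (by omega) (by omega))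
  · rintro (⟨h₁, h₂⟩ | ⟨h₁, h₂⟩)
    · exact hlastab i h₁ h₂
    · exact (hor i (by omega) (by omega) (by omega)).resolve_left
        (hemax _ (by omega) (by omega))

/-- If `a > 3`, then the vertex in position `b + 2`, which is an end of the Hamiltonian path
`b + 2, …, 1, b + 3, …, n`, has too few neighbours. -/
lemma HasInterlacedEnds.eq_three {a b e : ℕ} (hs : HasInterlacedEnds G p (2 * k) a b e)
    (h : IsExtremalPath G p (2 * k)) (hV : Fintype.card V = 2 * k)
    (hdeg : ∀ v, k - 1 ≤ G.degree v) : a = 3 := by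
  obtain ⟨h₁, h₂, h₃, h₄, hf, hl⟩ := hs
  by_contra hne
  have hd1 := (hdeg (p 1)).trans (h.degree_le hV (Finset.Icc 2 a ∪ Finset.Icc (b + 3) e)
    fun i hi₁ hi hadj => by
      have := (hf i hi₁ hi).1 hadj
      simpa using this)
  have hdn := (hdeg (p (2 * k))).trans (h.degree_le hV
    (Finset.Icc a b ∪ Finset.Icc e (2 * k - 1)) fun i hi₁ hi hadj => by
      have := (hl i hi₁ hi).1 hadj
      simpa using this)
  have hdm := (hdeg (p (b + 2))).trans (h.degree_le hV
    (Finset.Icc 2 (a - 3) ∪ (Finset.Icc b (b + 1) ∪ Finset.Icc (b + 3) e))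
    fun i hi₁ hi hadj => by
      have hfb := (hf (b + 3) (by omega) (by omega)).2 (by omega)
      have hi1 : i ≠ 1 := by
        rintro rfl
        have := (hf (b + 2) (by omega) (by omega)).1 hadj.symm
        omega
      have hib : i ≠ b + 2 := by rintro rfl; exact hadj.ne rfl
      by_contra hno
      simp only [Finset.mem_union, Finset.mem_Icc] at hno
      by_cases hie : e < i
      · exact h.not_adj_of_adj_ends (i := b + 2) (i' := b + 3) (j' := i - 1) (j := i) (by omega)
          (by omega) (by omega) (by omega) hi (by omega) hfb
          ((hl (i - 1) (by omega) (by omega)).2 (by omega)) hadj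
      · by_cases hia : i = a - 2
        · exact h.not_adj_of_adj_succ (t := i) (s := i + 2) (u := b + 2) hi₁ (by omega) (by omega)
            (by omega) (by omega) hfb ((hl (i + 2) (by omega) (by omega)).2 (by omega)) hadj.symm
        · exact h.not_adj_of_adj_succ (t := i) (s := i + 1) (u := b + 2) hi₁ (by omega) (by omega)
            (by omega) (by omega) hfb ((hl (i + 1) (by omega) (by omega)).2 (by omega)) hadj.symm)
  have e₁ := Finset.card_union_le (Finset.Icc 2 a) (Finset.Icc (b + 3) e)
  have e₂ := Finset.card_union_le (Finset.Icc a b) (Finset.Icc e (2 * k - 1))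
  have e₃ := Finset.card_union_le (Finset.Icc 2 (a - 3))
    (Finset.Icc b (b + 1) ∪ Finset.Icc (b + 3) e)
  have e₄ := Finset.card_union_le (Finset.Icc b (b + 1)) (Finset.Icc (b + 3) e)
  simp only [Nat.card_Icc] at e₁ e₂ e₃ e₄
  omega

/-- The neighbours of the second vertex of the path: it is an end of the Hamiltonian path
`2, 1, 3, …, n`. -/
lemma HasInterlacedEnds.adj_two {b e : ℕ} (hs : HasInterlacedEnds G p (2 * k) 3 b e)
    (he : e = 2 * k - 2) (hb : b = k - 1)
    (h : IsExtremalPath G p (2 * k)) (hV : Fintype.card V = 2 * k)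
    (hdeg : ∀ v, k - 1 ≤ G.degree v) {i : ℕ} (hi₁ : 1 ≤ i) (hi : i ≤ 2 * k) :
    G.Adj (p 2) (p i) ↔ i = 1 ∨ i = 3 ∨ k + 2 ≤ i ∧ i ≤ 2 * k - 2 := by
  subst he hb
  obtain ⟨h₁, h₂, h₃, h₄, hf, hl⟩ := hs
  have hf3 := (hf 3 (by omega) (by omega)).2 (by omega)
  have hsub : ∀ i, 1 ≤ i → i ≤ 2 * k → G.Adj (p 2) (p i) →
      i ∈ insert 1 (insert 3 (Finset.Icc (k + 2) (2 * k - 2))) := by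
    intro i hi₁ hi hadj
    have hi2 : i ≠ 2 := by rintro rfl; exact hadj.ne rfl
    simp only [Finset.mem_insert, Finset.mem_Icc]
    by_contra hno
    by_cases hik : i = k + 1
    · exact h.not_adj_of_adj_ends (i := 2) (i' := 3) (j' := i - 2) (j := i) (by omega)
        (by omega) (by omega) (by omega) hi (by omega) hf3
        ((hl (i - 2) (by omega) (by omega)).2 (by omega)) hadj
    · exact h.not_adj_of_adj_ends (i := 2) (i' := 3) (j' := i - 1) (j := i) (by omega)
        (by omega) (by omega) (by omega) hi (by omega) hf3
        ((hl (i - 1) (by omega) (by omega)).2 (by omega)) hadj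
  constructor
  · intro hadj
    simpa using hsub i hi₁ hi hadj
  · intro hi'
    refine h.adj_of_card_le hV _ hsub ?_ (by simpa using hi')
    refine le_trans ?_ (hdeg (p 2))
    refine (Finset.card_insert_le _ _).trans ?_
    refine (Nat.add_le_add_right (Finset.card_insert_le _ _) 1).trans ?_
    rw [Nat.card_Icc]
    omega

/-- By `eq_three` for the path and its reversal, and by the degrees of the ends, only `k` is free. In
the second half of the path the first and the second vertex have the same neighbours; if there were two consecutive ones, then
moving the first two vertices between them would give a Hamiltonian cycle. -/
lemma HasInterlacedEnds.parameters_eq {a b e : ℕ} (hs : HasInterlacedEnds G p (2 * k) a b e)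
    (h : IsExtremalPath G p (2 * k)) (hV : Fintype.card V = 2 * k)
    (hdeg : ∀ v, k - 1 ≤ G.degree v) : k = 4 ∧ a = 3 ∧ b = 3 ∧ e = 6 := by
  obtain rfl := hs.eq_three h hV hdeg
  have he := hs.reflect.eq_three h.reflect hV hdeg
  have hs' := hs
  obtain ⟨h₁, h₂, h₃, h₄, hf, hl⟩ := hs'
  have hd1 := (hdeg (p 1)).trans (h.degree_le hV (Finset.Icc 2 3 ∪ Finset.Icc (b + 3) e)
    fun i hi₁ hi hadj => by
      have := (hf i hi₁ hi).1 hadj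
      simpa using this)
  have hdn := (hdeg (p (2 * k))).trans (h.degree_le hV
    (Finset.Icc 3 b ∪ Finset.Icc e (2 * k - 1)) fun i hi₁ hi hadj => by
      have := (hl i hi₁ hi).1 hadj
      simpa using this)
  have e₁ := Finset.card_union_le (Finset.Icc 2 3) (Finset.Icc (b + 3) e)
  have e₂ := Finset.card_union_le (Finset.Icc 3 b) (Finset.Icc e (2 * k - 1))
  simp only [Nat.card_Icc] at e₁ e₂
  have hb : b = k - 1 := by omega
  have he' : e = 2 * k - 2 := by omega
  have hk : k = 4 := by
    by_contra hne
    refine h.not_adj_of_adj_insert (s := 2) (u := k + 2) (by omega) (by omega) (by omega)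
      ((hf _ (by omega) (by omega)).2 (by omega)) ((hl _ (by omega) (by omega)).2 (by omega)) ?_
    exact (hs.adj_two he' hb h hV hdeg (by omega) (by omega)).2 (by omega)
  omega

/-- With `8` vertices the degree condition leaves only `F₂`: three disjoint edges, all joined to
the vertices in positions `3` and `6`. The latter form a part and hence are not adjacent. -/
lemma HasInterlacedEnds.nonempty_iso (hs : HasInterlacedEnds G p 8 3 3 6)
    (h : IsExtremalPath G p 8) (hV : Fintype.card V = 8) (hk : k = 4) (hσ : IsPartnerMap c σ)
    (hdeg : ∀ v, k - 1 ≤ G.degree v) : Nonempty (G ≃g graphFTwo) := by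
  subst hk
  have hrow2 : ∀ i, 1 ≤ i → i ≤ 8 → (G.Adj (p 2) (p i) ↔ i = 1 ∨ i = 3 ∨ i = 6) := by
    intro i hi₁ hi
    rw [hs.adj_two (k := 4) rfl rfl h hV hdeg hi₁ hi]
    omega
  have hrow7 : ∀ i, 1 ≤ i → i ≤ 8 → (G.Adj (p 7) (p i) ↔ i = 8 ∨ i = 6 ∨ i = 3) := by
    intro i hi₁ hi
    have := hs.reflect.adj_two (k := 4) rfl rfl h.reflect hV hdeg (i := 9 - i)
      (by omega) (by omega)
    simp only [show 2 * 4 + 1 - 2 = 7 from rfl, show 2 * 4 + 1 - (9 - i) = i by omega] at this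
    rw [this]
    omega
  obtain ⟨-, -, -, -, hf, hl⟩ := hs
  have hrow : ∀ P : Finset ℕ, P.card = 3 → ∀ v, (∀ i, 1 ≤ i → i ≤ 8 → G.Adj v (p i) → i ∈ P) →
      ∀ i ∈ P, G.Adj v (p i) := fun P hP v hv i hi =>
    h.adj_of_card_le (k := 4) hV P hv (hP ▸ hdeg v) hi
  have hnot : ∀ j, j = 4 ∨ j = 5 → ∀ i, 1 ≤ i → i ≤ 8 → G.Adj (p j) (p i) →
      i = 3 ∨ i = 4 ∨ i = 5 ∨ i = 6 := by
    intro j hj i hi₁ hi hadj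
    by_contra hno
    have : i = 1 ∨ i = 2 ∨ i = 7 ∨ i = 8 := by omega
    rcases this with rfl | rfl | rfl | rfl
    · have := (hf j (by omega) (by omega)).1 hadj.symm; omega
    · have := (hrow2 j (by omega) (by omega)).1 hadj.symm; omega
    · have := (hrow7 j (by omega) (by omega)).1 hadj.symm; omega
    · have := (hl j (by omega) (by omega)).1 hadj.symm; omega
  have hrow4 : ∀ i, 1 ≤ i → i ≤ 8 → (G.Adj (p 4) (p i) ↔ i = 3 ∨ i = 5 ∨ i = 6) := by
    have hsub : ∀ i, 1 ≤ i → i ≤ 8 → G.Adj (p 4) (p i) → i ∈ ({3, 5, 6} : Finset ℕ) := by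
      intro i hi₁ hi hadj
      have := hnot 4 (by omega) i hi₁ hi hadj
      have hi4 : i ≠ 4 := by rintro rfl; exact hadj.ne rfl
      simp; omega
    exact fun i hi₁ hi => ⟨fun hadj => by simpa using hsub i hi₁ hi hadj,
      fun hi' => hrow _ rfl _ hsub i (by simpa using hi')⟩
  have hrow5 : ∀ i, 1 ≤ i → i ≤ 8 → (G.Adj (p 5) (p i) ↔ i = 3 ∨ i = 4 ∨ i = 6) := by
    have hsub : ∀ i, 1 ≤ i → i ≤ 8 → G.Adj (p 5) (p i) → i ∈ ({3, 4, 6} : Finset ℕ) := by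
      intro i hi₁ hi hadj
      have := hnot 5 (by omega) i hi₁ hi hadj
      have hi4 : i ≠ 5 := by rintro rfl; exact hadj.ne rfl
      simp; omega
    exact fun i hi₁ hi => ⟨fun hadj => by simpa using hsub i hi₁ hi hadj,
      fun hi' => hrow _ rfl _ hsub i (by simpa using hi')⟩
  have h3 : ∀ j, j = 1 ∨ j = 2 ∨ j = 4 ∨ j = 5 ∨ j = 7 ∨ j = 8 →
      G.Adj (p j) (p 3) ∧ G.Adj (p j) (p 6) := by
    rintro j (rfl | rfl | rfl | rfl | rfl | rfl)
    · exact ⟨(hf _ (by omega) (by omega)).2 (by omega), (hf _ (by omega) (by omega)).2 (by omega)⟩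
    · exact ⟨(hrow2 _ (by omega) (by omega)).2 (by omega),
        (hrow2 _ (by omega) (by omega)).2 (by omega)⟩
    · exact ⟨(hrow4 _ (by omega) (by omega)).2 (by omega),
        (hrow4 _ (by omega) (by omega)).2 (by omega)⟩
    · exact ⟨(hrow5 _ (by omega) (by omega)).2 (by omega),
        (hrow5 _ (by omega) (by omega)).2 (by omega)⟩
    · exact ⟨(hrow7 _ (by omega) (by omega)).2 (by omega),
        (hrow7 _ (by omega) (by omega)).2 (by omega)⟩
    · exact ⟨(hl _ (by omega) (by omega)).2 (by omega), (hl _ (by omega) (by omega)).2 (by omega)⟩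
  have h36 : ¬ G.Adj (p 3) (p 6) := by
    obtain ⟨i, hi₁, hi, hiσ⟩ := h.exists_eq (k := 4) hV (σ (p 3))
    have hnadj := hσ.not_adj_left (p 3)
    rw [← hiσ] at hnadj
    by_cases hi6 : i = 6
    · subst hi6
      exact fun hadj => hnadj hadj.symm
    by_cases hi3 : i = 3
    · subst hi3
      exact absurd hiσ.symm (hσ.ne _)
    · exact absurd (h3 i (by omega)).1 hnadj
  -- `3` and `6` are joined to everything else; the other edges are `12`, `45`, `78`
  have htable : ∀ i j, 1 ≤ i → i ≤ 8 → 1 ≤ j → j ≤ 8 → (G.Adj (p i) (p j) ↔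
      (i % 3 = 0 ∧ j % 3 ≠ 0) ∨ (i % 3 ≠ 0 ∧ j % 3 = 0) ∨
        (i % 3 ≠ 0 ∧ j % 3 ≠ 0 ∧ i / 3 = j / 3 ∧ i ≠ j)) := by
    intro i j hi₁ hi hj₁ hj
    by_cases hi36 : i = 3 ∨ i = 6
    · by_cases hj36 : j = 3 ∨ j = 6
      · have : ¬ G.Adj (p i) (p j) := by
          rcases hi36 with rfl | rfl <;> rcases hj36 with rfl | rfl
          · exact G.loopless.irrefl _
          · exact h36
          · exact fun hadj => h36 hadj.symm
          · exact G.loopless.irrefl _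
        simp only [this, false_iff]
        omega
      · have : G.Adj (p i) (p j) := by
          have := h3 j (by omega)
          rcases hi36 with rfl | rfl
          · exact this.1.symm
          · exact this.2.symm
        simp only [this, true_iff]
        omega
    · have : i = 1 ∨ i = 2 ∨ i = 4 ∨ i = 5 ∨ i = 7 ∨ i = 8 := by omega
      rcases this with rfl | rfl | rfl | rfl | rfl | rfl
      · rw [hf j hj₁ hj]; omega
      · rw [hrow2 j hj₁ hj]; omega
      · rw [hrow4 j hj₁ hj]; omega
      · rw [hrow5 j hj₁ hj]; omega
      · rw [hrow7 j hj₁ hj]; omega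
      · rw [hl j hj₁ hj]; omega
  set r : Fin 8 → ℕ := ![3, 1, 2, 6, 4, 5, 7, 8] with hr
  have hr₁ : ∀ i, 1 ≤ r i ∧ r i ≤ 8 := by decide
  have hrinj : Function.Injective r := by decide
  have hpr : Function.Bijective fun i => p (r i) := by
    rw [Fintype.bijective_iff_injective_and_card]
    exact ⟨fun i j hij => hrinj (h.path.injOn (hr₁ i) (hr₁ j) hij), by simp [hV]⟩
  refine ⟨(SimpleGraph.Iso.symm ⟨Equiv.ofBijective _ hpr, ?_⟩)⟩
  intro i j
  rw [Equiv.ofBijective_apply, Equiv.ofBijective_apply,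
    htable _ _ (hr₁ i).1 (hr₁ i).2 (hr₁ j).1 (hr₁ j).2]
  simp only [graphFTwo, SimpleGraph.fromEdgeSet_adj, Set.mem_insert_iff, Set.mem_singleton_iff]
  revert i j
  decide

end Interlaced

/-! ### The classification -/

theorem proposition2 (n k : ℕ) (hn : 8 ≤ n) (h4 : 4 ∣ n) (hk : k = n / 2) :
    (n : ℚ) / 2 + ⌊((n : ℚ) + 2) / ((k : ℚ) + 2)⌋ - (n : ℚ) / k = (n : ℚ) / 2 - 1 ∧
    ∀ {V : Type*} [Fintype V] [DecidableEq V] (G : SimpleGraph V) [DecidableRel G.Adj]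
      (c : G.Coloring (Fin k)),
      Fintype.card V = n → IsBalancedPartite c → n / 2 - 1 ≤ G.minDegree → ¬ G.IsHamiltonian →
      InFamilyOne c ∨ Nonempty (G ≃g graphFTwo) ∨ InFamilyThree c := by
  obtain ⟨m, rfl⟩ := h4
  obtain rfl : k = 2 * m := by omega
  have hm : 2 ≤ m := by omega
  constructor
  · have hm' : (2 : ℚ) ≤ m := by exact_mod_cast hm
    have hfloor : ⌊(((4 * m : ℕ) : ℚ) + 2) / (((2 * m : ℕ) : ℚ) + 2)⌋ = 1 := by
      rw [Int.floor_eq_iff]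
      push_cast
      constructor
      · rw [le_div_iff₀ (by linarith)]; linarith
      · rw [div_lt_iff₀ (by linarith)]; linarith
    rw [hfloor]
    push_cast
    have : (4 * (m : ℚ)) / (2 * m) = 2 := by field_simp; norm_num
    rw [this]
    ring
  · intro V _ _ G _ c hV hbal hmin hham
    have hV' : Fintype.card V = 2 * (2 * m) := by omega
    have hdeg : ∀ v, 2 * m - 1 ≤ G.degree v := fun v => by
      have := G.minDegree_le_degree v
      omega
    have hcycle : ¬ HasCycleOfCard G (2 * (2 * m)) := fun hcyc =>
      hham (HasCycleOfCard.isHamiltonian (by omega) (hV' ▸ hcyc))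
    obtain ⟨htwo, σ, hσ⟩ := exists_isPartnerMap hbal hV'
    by_cases hcyc : HasCycleOfCard G (2 * (2 * m) - 1)
    · exact Or.inr (Or.inr (hcyc.inFamilyThree hσ hV' (even_two_mul m) (by omega) htwo hdeg hcycle))
    rcases inFamily_or_hasPathOfCard hσ hV' (even_two_mul m) (by omega) htwo hdeg hcycle with
      hF | hF | ⟨p, hp⟩
    · exact Or.inl hF
    · exact Or.inr (Or.inr hF)
    have h : IsExtremalPath G p (2 * (2 * m)) := ⟨hp, hcycle, hcyc⟩
    by_cases hcross : ∃ i j, 1 ≤ i ∧ i < j ∧ j ≤ 2 * (2 * m) ∧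
        G.Adj (p (2 * (2 * m))) (p i) ∧ G.Adj (p 1) (p j)
    · obtain ⟨a, b, e, hs⟩ := h.exists_hasInterlacedEnds hV' (by omega) hdeg hcross
      obtain ⟨hm4, rfl, rfl, rfl⟩ := hs.parameters_eq h hV' hdeg
      obtain rfl : m = 2 := by omega
      exact Or.inr (Or.inl (hs.nonempty_iso h hV' rfl hσ hdeg))
    · refine Or.inl (h.inFamilyOne_of_not_cross hσ hV' (by omega) hdeg
        fun i j hi hij hj ha hb => hcross ⟨i, j, hi, hij, hj, ha, hb⟩)
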